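/- Let $M$ be an $n$-dimensional smooth manifold, $n\ge 2$, $\alpha=\sqrt{a_{ij}(x)y^iy^j}$ a smooth Riemannian metric and $\beta=b_i(x)y^i$ a smooth $1$-form on $M$, and write $b=b(x)=\|\beta_x\|_\alpha$. Let $0<b_0\le\infty$, let $\phi=\phi(b^2,s)$ be a positive smooth function on $\{|s|\le b<b_0\}$, and suppose that $b(x)<b_0$ for all $x\in M$ and that the general $(\alpha,\beta)$-metric $$F=\alpha\,\phi\!\left(b^2,\frac{\beta}{\alpha}\right)$$ is a Finsler metric (smooth off the zero section, positive, positively homogeneous of degree one, with positive definite fundamental tensor $g_{ij}=\tfrac12[F^2]_{y^iy^j}$) which is not Riemannian. Suppose that $b_{i|j}=c(x)a_{ij}$ for a function $c$ on $M$ without zeros, where $b_{i|j}$ is the covariant derivative of $\beta$ with respect to $\alpha$. Write $\phi_1,\phi_2$ for the partial derivatives of $\phi$ with respect to $b^2$ and $s$, and set $$H=\frac{\phi_{22}-2(\phi_1-s\phi_{12})}{2\,[\phi-s\phi_2+(b^2-s^2)\phi_{22}]}.$$ $F$ is called a Douglas metric if $$D^i{}_{jkl}=\frac{\partial^3}{\partial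 y^j\partial y^k\partial y^l}\Big(G^i-\frac1{n+1}\frac{\partial G^m}{\partial y^m}y^i\Big)=0,\qquad G^i=\tfrac14 g^{il}\{[F^2]_{x^ky^l}y^k-[F^2]_{x^l}\},$$ in all local coordinates and for all $y\ne0$. Then the following are equivalent: 1. $F$ is a Douglas metric. 2. There are functions $f,g$, smooth on the set $\{b(x)^2: x\in M\}$, such that for every $x\in M$ and every $s$ with $|s|\le b=b(x)$, at the point $(b^2,s)$, $$\phi_{22}-2(\phi_1-s\phi_{12})=\{f(b^2)+g(b^2)s^2\}\{\phi-s\phi_2+(b^2-s^2)\phi_{22}\}.$$ 3. There are functions $f,g$, with no regularity required, such that the equation in 2 holds for every $x\in M$ and every $s$ with $|s|\le b(x)$. 4. $H_2-sH_{22}=0$ at $(b(x)^2,s)$ for every $x\in M$ and every $s$ with $|s|\le b(x)$. -/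

import Mathlib

open scoped Manifold ContDiff Matrix

noncomputable section

namespace GeneralAlphaBeta

/-- The coordinate space `ℝⁿ`. -/
abbrev Coord (n : ℕ) : Type := EuclideanSpace ℝ (Fin n)

/-- The `i`-th partial derivative of a function on `ℝⁿ`. -/
def pd {n : ℕ} (h : Coord n → ℝ) (i : Fin n) (u : Coord n) : ℝ :=
  fderiv ℝ h u (EuclideanSpace.single i 1)

/-! ### Finsler geometry in coordinates

Here `L u y` is the expression of a Finsler metric in a coordinate chart: `u` is the coordinate of
the base point (the `x` of the classical notation), `y` the fibre coordinate. -/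

/-- The fundamental tensor `g_{ij} = ½ [F²]_{yⁱ yʲ}`. -/
def fundamentalTensor {n : ℕ} (L : Coord n → Coord n → ℝ) (u y : Coord n) :
    Matrix (Fin n) (Fin n) ℝ :=
  Matrix.of fun i j => (1 / 2) * pd (fun y' => pd (fun y'' => L u y'' ^ 2) i y') j y

/-- The geodesic (spray) coefficients
`Gⁱ = ¼ g^{il} ([F²]_{xᵏ yˡ} yᵏ - [F²]_{xˡ})`, where `(g^{il}) = (g_{il})⁻¹`. -/
def sprayCoeff {n : ℕ} (L : Coord n → Coord n → ℝ) (i : Fin n) (u y : Coord n) : ℝ :=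
  (1 / 4) * ∑ l, (fundamentalTensor L u y)⁻¹ i l *
    ((∑ k, pd (fun y' => pd (fun u' => L u' y' ^ 2) k u) l y * y k)
      - pd (fun u' => L u' y ^ 2) l u)

/-- The components
`Dⁱ_{jkl} = ∂³/∂yʲ∂yᵏ∂yˡ (Gⁱ - (n+1)⁻¹ (∂Gᵐ/∂yᵐ) yⁱ)` of the Douglas tensor. -/
def douglasCoeff {n : ℕ} (L : Coord n → Coord n → ℝ) (i j k l : Fin n) (u y : Coord n) : ℝ :=
  pd (fun y₁ => pd (fun y₂ => pd (fun y₃ =>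
    sprayCoeff L i u y₃ - 1 / ((n : ℝ) + 1) * (∑ m, pd (fun y₄ => sprayCoeff L m u y₄) m y₃) * y₃ i)
    l y₂) k y₁) j y

/-! ### Covariant derivative of a 1-form in coordinates

Here `a u i j` are the components of a Riemannian metric, `b u i` those of a 1-form. -/

/-- The Christoffel symbols `Γᵏ_{ij} = ½ a^{kl} (∂_i a_{jl} + ∂_j a_{il} - ∂_l a_{ij})`. -/
def christoffel {n : ℕ} (a : Coord n → Matrix (Fin n) (Fin n) ℝ) (k i j : Fin n)
    (u : Coord n) : ℝ :=
  (1 / 2) * ∑ l, (a u)⁻¹ k l *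
    (pd (fun u' => a u' j l) i u + pd (fun u' => a u' i l) j u - pd (fun u' => a u' i j) l u)

/-- The covariant derivative `b_{i|j} = ∂_j b_i - Γᵏ_{ij} b_k`. -/
def covDeriv {n : ℕ} (a : Coord n → Matrix (Fin n) (Fin n) ℝ) (b : Coord n → Fin n → ℝ)
    (i j : Fin n) (u : Coord n) : ℝ :=
  pd (fun u' => b u' i) j u - ∑ k, christoffel a k i j u * b u k

/-! ### Objects on a manifold -/

section Manifold

variable {n : ℕ} {M : Type*} [TopologicalSpace M] [ChartedSpace (Coord n) M]

/-- For a chart `e` with coordinates `(xⁱ)`, the tangent vector `vⁱ ∂/∂xⁱ` at the point with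
coordinates `u`, as the image of `v` under the differential of the inverse chart. -/
def coordVec (e : OpenPartialHomeomorph M (Coord n)) (u v : Coord n) :
    TangentSpace (𝓡 n) (e.symm u) :=
  mfderiv (𝓡 n) (𝓡 n) e.symm u v

/-- The expression `F(x, y)` in a chart of a function on the tangent bundle. -/
def inChart (F : (x : M) → TangentSpace (𝓡 n) x → ℝ) (e : OpenPartialHomeomorph M (Coord n))
    (u y : Coord n) : ℝ :=
  F (e.symm u) (coordVec e u y)

variable [IsManifold (𝓡 n) ∞ M]

variable (n M) in
/-- Smooth Riemannian metrics on `M`. -/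
abbrev RMetric : Type _ :=
  Bundle.ContMDiffRiemannianMetric (𝓡 n) ∞ (Coord n) (fun x : M => TangentSpace (𝓡 n) x)

variable (n M) in
/-- Smooth 1-forms on `M`, i.e. smooth sections of the cotangent bundle. -/
abbrev OneForm : Type _ :=
  ContMDiffSection (𝓡 n) (Coord n →L[ℝ] ℝ) ∞
    (fun x : M => TangentSpace (𝓡 n) x →L[ℝ] Bundle.Trivial M ℝ x)

/-- The value `β_x(y)`, a real number. -/
def OneForm.val (β : OneForm n M) (x : M) (y : TangentSpace (𝓡 n) x) : ℝ := β x y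

/-- The norm `α(x, y) = √(a_{ij}(x) yⁱ yʲ)` of a Riemannian metric. -/
def RMetric.norm (a : RMetric n M) (x : M) (y : TangentSpace (𝓡 n) x) : ℝ :=
  √(a.inner x y y)

/-- The components `a_{ij}` of a Riemannian metric in a chart. -/
def RMetric.comp (a : RMetric n M) (e : OpenPartialHomeomorph M (Coord n)) (u : Coord n) :
    Matrix (Fin n) (Fin n) ℝ :=
  Matrix.of fun i j =>
    a.inner (e.symm u) (coordVec e u (EuclideanSpace.single i 1))
      (coordVec e u (EuclideanSpace.single j 1))

/-- The components `b_i` of a 1-form in a chart. -/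
def OneForm.comp (β : OneForm n M) (e : OpenPartialHomeomorph M (Coord n)) (u : Coord n)
    (i : Fin n) : ℝ :=
  β.val (e.symm u) (coordVec e u (EuclideanSpace.single i 1))

/-- The norm `b = ‖β_x‖_α = sup {|β_x(y)| : α(x, y) ≤ 1}`. -/
def formNorm (a : RMetric n M) (β : OneForm n M) (x : M) : ℝ :=
  sSup ((fun y : TangentSpace (𝓡 n) x => |β.val x y|) '' {y | a.norm x y ≤ 1})

/-- The equation `b_{i|j} = c(x) a_{ij}`, in all charts. -/
def IsClosedConformal (a : RMetric n M) (β : OneForm n M) (c : M → ℝ) : Prop :=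
  ∀ e ∈ IsManifold.maximalAtlas (𝓡 n) ∞ M, ∀ u ∈ e.target, ∀ i j : Fin n,
    covDeriv (a.comp e) (β.comp e) i j u = c (e.symm u) * a.comp e u i j

/-- Finsler metrics on `M`: functions on the tangent bundle that are smooth off the zero section,
positive, positively homogeneous of degree one, and strongly convex (the fundamental tensor is
positive definite). -/
structure IsFinslerMetric (F : (x : M) → TangentSpace (𝓡 n) x → ℝ) : Prop where
  smooth : ContMDiffOn (𝓡 n).tangent 𝓘(ℝ, ℝ) ∞
    (fun v : TangentBundle (𝓡 n) M => F v.1 v.2) {v | v.2 ≠ 0}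
  pos : ∀ (x : M) (y : TangentSpace (𝓡 n) x), y ≠ 0 → 0 < F x y
  homog : ∀ (x : M) (y : TangentSpace (𝓡 n) x) (r : ℝ), 0 < r → F x (r • y) = r * F x y
  convex : ∀ e ∈ IsManifold.maximalAtlas (𝓡 n) ∞ M, ∀ u ∈ e.target, ∀ y : Coord n, y ≠ 0 →
    (fundamentalTensor (inChart F e) u y).PosDef

/-- `F` is Riemannian: `F = √(h_{ij}(x) yⁱ yʲ)` for some Riemannian metric `h`. -/
def IsRiemannian (F : (x : M) → TangentSpace (𝓡 n) x → ℝ) : Prop :=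
  ∃ h : RMetric n M, ∀ (x : M) (y : TangentSpace (𝓡 n) x), F x y = h.norm x y

/-- `F` is a Douglas metric: its Douglas tensor vanishes (at all `(x, y)` with `y ≠ 0`). -/
def IsDouglas (F : (x : M) → TangentSpace (𝓡 n) x → ℝ) : Prop :=
  ∀ e ∈ IsManifold.maximalAtlas (𝓡 n) ∞ M, ∀ u ∈ e.target, ∀ y : Coord n, y ≠ 0 →
    ∀ i j k l : Fin n, douglasCoeff (inChart F e) i j k l u y = 0

/-- The function `F = α φ(b², β/α)`, with value `0` on the zero section. -/
def genMetric (a : RMetric n M) (β : OneForm n M) (φ : ℝ × ℝ → ℝ) (x : M)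
    (y : TangentSpace (𝓡 n) x) : ℝ :=
  a.norm x y * φ (formNorm a β x ^ 2, β.val x y / a.norm x y)

end Manifold

/-! ### The function `φ(b², s)` and its partial derivatives -/

/-- The set of all `(b², s)` with `|s| ≤ b < b₀`, where `b₀` may be infinite. -/
def phiDomain (b₀ : EReal) : Set (ℝ × ℝ) :=
  {p | ∃ b : ℝ, p.1 = b ^ 2 ∧ |p.2| ≤ b ∧ (b : EReal) < b₀}

/-- `φ` is positive and smooth on the domain `|s| ≤ b < b₀`. The domain is not open, so smooth means,
as usual, that `φ` is (the restriction of) a smooth function on an open set containing it; the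
partial derivatives at points of the domain do not depend on the extension. -/
structure IsPhi (φ : ℝ × ℝ → ℝ) (b₀ : EReal) : Prop where
  smooth : ∃ U : Set (ℝ × ℝ), IsOpen U ∧ phiDomain b₀ ⊆ U ∧ ContDiffOn ℝ ∞ φ U
  pos : ∀ p ∈ phiDomain b₀, 0 < φ p

/-- Derivative with respect to the first variable `b²`. -/
def d1 (h : ℝ × ℝ → ℝ) (p : ℝ × ℝ) : ℝ := fderiv ℝ h p (1, 0)

/-- Derivative with respect to the second variable `s`. -/
def d2 (h : ℝ × ℝ → ℝ) (p : ℝ × ℝ) : ℝ := fderiv ℝ h p (0, 1)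

/-- `φ₂₂ - 2 (φ₁ - s φ₁₂)` at `p = (b², s)`. -/
def pdeNum (φ : ℝ × ℝ → ℝ) (p : ℝ × ℝ) : ℝ :=
  d2 (d2 φ) p - 2 * (d1 φ p - p.2 * d2 (d1 φ) p)

/-- `φ - s φ₂ + (b² - s²) φ₂₂` at `p = (b², s)`. -/
def pdeDen (φ : ℝ × ℝ → ℝ) (p : ℝ × ℝ) : ℝ :=
  φ p - p.2 * d2 φ p + (p.1 - p.2 ^ 2) * d2 (d2 φ) p

/-- `H = (φ₂₂ - 2 (φ₁ - s φ₁₂)) / (2 [φ - s φ₂ + (b² - s²) φ₂₂])`. -/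
def Hfun (φ : ℝ × ℝ → ℝ) (p : ℝ × ℝ) : ℝ := pdeNum φ p / (2 * pdeDen φ p)

end GeneralAlphaBeta

end

open scoped Manifold ContDiff Matrix

noncomputable section

namespace GeneralAlphaBeta

/-! In a chart, metric compatibility and `b_{i|j} = c a_{ij}` make every base derivative of `F²` a
Christoffel term plus `c` times a function of the fibre. Solving for the spray (`sprayCoeff_eq`)
gives `Gⁱ = ½ Γⁱ_{kj} yᵏyʲ + c (α E yⁱ + α² H bⁱ)`, where `bⁱ = a^{ij} b_j` and `E` is `projFactor`.
The denominator of `H` is positive because strong convexity can be tested on a vector tangent to the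
indicatrix (`pdeDen_pos`).

Subtracting the divergence term removes `α E yⁱ`: by Euler's relation, `P yⁱ` has divergence `(n+1)
P` when `P` has degree one. By `exists_projSpray_eq`, a quadratic form in `y` plus `c (W bⁱ -
(n+1)⁻¹ bᵐ W_m yⁱ)` is left, with `W = α² H`, and the Douglas tensor is its third derivative. If `H
= (f + g s²)/2` then `W` is a quadratic form and the tensor vanishes (`douglasCoeff_eq_zero`).

Conversely (`exists_Hfun_eq`), contract with a covector `ξ` annihilating `bⁱ`. Since `bᵐ W_m = α J`
with `J = 2 s H + (b² - s²) H₂`, vanishing third derivatives make `ξ(y) α J` quadratic on every line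
missing the origin. Two lines in a plane spanned by the direction of `b` and an orthogonal vector
force `J = κ s` (`exists_eq_mul_of_isQuadraticPoly`). The resulting linear equation in `s` has the
solutions `H = κ/2 + μ (b² - s²)` (`exists_quadratic_of_ode`).

On a slice `b² = t > 0`, the equation `H₂ = s H₂₂` also characterises the polynomials `(f + g
s²)/2`; it yields `f = 2 H(t, 0)` and `g = H₂₂(t, 0)`, so regularity of `f` and `g` is automatic
(`IsAdmissible.Hfun_eq_of_ode`). On the slice `b = 0`, which is one point, condition 3 says nothing
about `H₂`; there `H₂ = 0` follows by continuity, because `c ≠ 0` prevents `β` from vanishing on an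
open set (`frequently_normSq_ne_zero`). -/

/-! ### Gradients of functions on coordinate space -/

/-- The functional `v ↦ wᵢ vⁱ`. -/
def lin {n : ℕ} (w : Fin n → ℝ) : Coord n →L[ℝ] ℝ := ∑ i, w i • EuclideanSpace.proj i

lemma lin_apply {n : ℕ} (w : Fin n → ℝ) (v : Coord n) : lin w v = ∑ i, w i * v i := by
  simp [lin]

/-- `h` is differentiable at `y` with partial derivatives `w`. -/
def HasGrad {n : ℕ} (h : Coord n → ℝ) (w : Fin n → ℝ) (y : Coord n) : Prop :=
  HasFDerivAt h (lin w) y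

section

variable {n : ℕ} {h k : Coord n → ℝ} {w w' : Fin n → ℝ} {y : Coord n}

lemma lin_ext {f : Coord n →L[ℝ] ℝ} (hf : ∀ i, f (EuclideanSpace.single i 1) = w i) :
    f = lin w := by
  ext v
  have hv : v = ∑ i, v i • EuclideanSpace.single i (1 : ℝ) := by
    ext j
    simp [Finset.sum_apply, Pi.single_apply]
  conv_lhs => rw [hv]
  rw [map_sum, lin_apply]
  refine Finset.sum_congr rfl fun i _ => ?_
  rw [map_smul, hf, smul_eq_mul, mul_comm]

lemma HasGrad.pd (hh : HasGrad h w y) (i : Fin n) : pd h i y = w i := by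
  rw [GeneralAlphaBeta.pd, hh.fderiv, lin_apply]
  simp

lemma _root_.HasFDerivAt.hasGrad {f : Coord n →L[ℝ] ℝ} (hh : HasFDerivAt h f y)
    (hf : ∀ i, f (EuclideanSpace.single i 1) = w i) : HasGrad h w y := by
  rw [HasGrad, ← lin_ext hf]
  exact hh

lemma _root_.DifferentiableAt.hasGrad (hh : DifferentiableAt ℝ h y) :
    HasGrad h (fun i => GeneralAlphaBeta.pd h i y) y :=
  hh.hasFDerivAt.hasGrad fun _ => rfl

lemma HasGrad.congr_grad (hh : HasGrad h w y) (e : ∀ i, w i = w' i) : HasGrad h w' y := by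
  rwa [← (funext e : w = w')]

lemma HasGrad.congr (hh : HasGrad h w y) (e : ∀ᶠ z in nhds y, k z = h z) : HasGrad k w y :=
  HasFDerivAt.congr_of_eventuallyEq hh e

lemma hasGrad_const (r : ℝ) : HasGrad (fun _ : Coord n => r) (fun _ => 0) y :=
  (hasFDerivAt_const r y).hasGrad fun _ => rfl

lemma hasGrad_coord (j : Fin n) :
    HasGrad (fun z : Coord n => z j) (fun i => if i = j then 1 else 0) y :=
  (EuclideanSpace.proj (𝕜 := ℝ) j).hasFDerivAt.hasGrad fun i => by
    simp [eq_comm]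

lemma HasGrad.add (hh : HasGrad h w y) (hk : HasGrad k w' y) :
    HasGrad (fun z => h z + k z) (fun i => w i + w' i) y :=
  (HasFDerivAt.add hh hk).hasGrad fun i => by simp [lin_apply]

lemma HasGrad.mul (hh : HasGrad h w y) (hk : HasGrad k w' y) :
    HasGrad (fun z => h z * k z) (fun i => w i * k y + h y * w' i) y :=
  (HasFDerivAt.mul hh hk).hasGrad fun i => by simp [lin_apply]; ring

lemma HasGrad.const_mul (r : ℝ) (hh : HasGrad h w y) :
    HasGrad (fun z => r * h z) (fun i => r * w i) y :=
  ((hasGrad_const r).mul hh).congr_grad fun i => by simp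

lemma HasGrad.sum {ι : Type*} {s : Finset ι} {h : ι → Coord n → ℝ} {w : ι → Fin n → ℝ}
    (hh : ∀ j ∈ s, HasGrad (h j) (w j) y) :
    HasGrad (fun z => ∑ j ∈ s, h j z) (fun i => ∑ j ∈ s, w j i) y := by
  have := HasFDerivAt.fun_sum (fun j hj => (hh j hj : HasFDerivAt (h j) (lin (w j)) y))
  exact this.hasGrad fun i => by simp [lin_apply]

lemma HasGrad.scalar_comp {g : ℝ → ℝ} {g' : ℝ} (hg : HasDerivAt g g' (h y))
    (hh : HasGrad h w y) : HasGrad (fun z => g (h z)) (fun i => g' * w i) y :=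
  (hg.comp_hasFDerivAt y hh).hasGrad fun i => by simp [lin_apply]

lemma HasGrad.comp_prod {f : ℝ × ℝ → ℝ} {T S : Coord n → ℝ} (hT : HasGrad T w y)
    (hS : HasGrad S w' y) (hf : DifferentiableAt ℝ f (T y, S y)) :
    HasGrad (fun z => f (T z, S z)) (fun i => d1 f (T y, S y) * w i + d2 f (T y, S y) * w' i) y :=
  (hf.hasFDerivAt.comp y (HasFDerivAt.prodMk hT hS)).hasGrad fun i => by
    have : ((w i, w' i) : ℝ × ℝ) = w i • (1, 0) + w' i • (0, 1) := by simp
    simp only [ContinuousLinearMap.comp_apply, ContinuousLinearMap.prod_apply, lin_apply, d1, d2]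
    simp only [PiLp.single_apply, mul_ite, mul_one, mul_zero, Finset.sum_ite_eq',
      Finset.mem_univ, if_true]
    rw [this, map_add, map_smul, map_smul, smul_eq_mul, smul_eq_mul]
    ring

lemma HasGrad.line {v : Coord n} {τ : ℝ} (hh : HasGrad h w (y + τ • v)) :
    HasDerivAt (fun r : ℝ => h (y + r • v)) (∑ i, w i * v i) τ := by
  have h1 : HasDerivAt (fun r : ℝ => y + r • v) v τ := by
    simpa using ((hasDerivAt_id τ).smul_const v).const_add y
  have := HasFDerivAt.comp_hasDerivAt τ (f := fun r : ℝ => y + r • v) hh h1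
  rwa [lin_apply] at this

lemma pd_congr {h k : Coord n → ℝ} (e : ∀ᶠ z in nhds y, h z = k z) (i : Fin n) :
    pd h i y = pd k i y := by
  rw [pd, pd, Filter.EventuallyEq.fderiv_eq e]

lemma contDiffAt_pd (hh : ContDiffAt ℝ ∞ h y) (i : Fin n) : ContDiffAt ℝ ∞ (pd h i) y :=
  (hh.fderiv_right (m := ∞) (by norm_cast)).clm_apply contDiffAt_const

end

/-! ### Partial derivatives of functions of two real variables -/

section

variable {h k : ℝ × ℝ → ℝ} {p : ℝ × ℝ}

lemma contDiffAt_d1 (hh : ContDiffAt ℝ ∞ h p) : ContDiffAt ℝ ∞ (d1 h) p :=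
  (hh.fderiv_right (m := ∞) (by norm_cast)).clm_apply contDiffAt_const

lemma contDiffAt_d2 (hh : ContDiffAt ℝ ∞ h p) : ContDiffAt ℝ ∞ (d2 h) p :=
  (hh.fderiv_right (m := ∞) (by norm_cast)).clm_apply contDiffAt_const

lemma hasDerivAt_d2 {t s : ℝ} (hh : DifferentiableAt ℝ h (t, s)) :
    HasDerivAt (fun r => h (t, r)) (d2 h (t, s)) s := by
  have h1 : HasDerivAt (fun r : ℝ => (t, r)) ((0 : ℝ), (1 : ℝ)) s :=
    (hasDerivAt_const s t).prodMk (hasDerivAt_id s)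
  exact HasFDerivAt.comp_hasDerivAt s hh.hasFDerivAt h1

lemma d2_eq_of_hasDerivAt {t s d : ℝ} (hh : DifferentiableAt ℝ h (t, s))
    (hd : HasDerivAt (fun r => h (t, r)) d s) : d2 h (t, s) = d :=
  (hasDerivAt_d2 hh).unique hd

end

/-! ### Linear algebra of a positive definite matrix and a covector -/

/-- The quadratic form `a_{ij} vⁱ vʲ`. -/
def quad {n : ℕ} (a : Matrix (Fin n) (Fin n) ℝ) (v : Fin n → ℝ) : ℝ := v ⬝ᵥ a *ᵥ v

/-- The squared norm `a^{ij} b_i b_j` of a covector. -/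
def normSq {n : ℕ} (a : Matrix (Fin n) (Fin n) ℝ) (b : Fin n → ℝ) : ℝ := b ⬝ᵥ a⁻¹ *ᵥ b

section

variable {n : ℕ} {a : Matrix (Fin n) (Fin n) ℝ} {b v w : Fin n → ℝ}

lemma symm_apply (ha : a.PosDef) (i j : Fin n) : a i j = a j i := by
  simpa using (ha.isHermitian.apply i j).symm

lemma dotProduct_mulVec_symm (ha : a.PosDef) (v w : Fin n → ℝ) :
    v ⬝ᵥ a *ᵥ w = w ⬝ᵥ a *ᵥ v := by
  have h : aᵀ = a := Matrix.ext fun i j => symm_apply ha j i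
  rw [Matrix.dotProduct_mulVec, ← Matrix.mulVec_transpose, h, dotProduct_comm]

lemma quad_pos (ha : a.PosDef) (hv : v ≠ 0) : 0 < quad a v := by
  have h := ha.dotProduct_mulVec_pos hv
  rwa [star_trivial] at h

lemma quad_nonneg (ha : a.PosDef) (v : Fin n → ℝ) : 0 ≤ quad a v := by
  rcases eq_or_ne v 0 with rfl | hv
  · simp [quad]
  · exact (quad_pos ha hv).le

lemma quad_smul (r : ℝ) (v : Fin n → ℝ) : quad a (r • v) = r ^ 2 * quad a v := by
  simp [quad, Matrix.mulVec_smul]; ring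

lemma quad_add (ha : a.PosDef) (v w : Fin n → ℝ) :
    quad a (v + w) = quad a v + 2 * (v ⬝ᵥ a *ᵥ w) + quad a w := by
  simp only [quad, Matrix.mulVec_add, dotProduct_add, add_dotProduct]
  rw [dotProduct_mulVec_symm ha w v]; ring

lemma mulVec_inv_mulVec (ha : a.PosDef) (b : Fin n → ℝ) : a *ᵥ (a⁻¹ *ᵥ b) = b := by
  rw [Matrix.mulVec_mulVec, Matrix.mul_nonsing_inv _ ha.det_pos.ne'.isUnit, Matrix.one_mulVec]

lemma inv_mulVec_mulVec (ha : a.PosDef) (b : Fin n → ℝ) : a⁻¹ *ᵥ (a *ᵥ b) = b := by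
  rw [Matrix.mulVec_mulVec, Matrix.nonsing_inv_mul _ ha.det_pos.ne'.isUnit, Matrix.one_mulVec]

lemma normSq_eq_quad (ha : a.PosDef) (b : Fin n → ℝ) : normSq a b = quad a (a⁻¹ *ᵥ b) := by
  rw [normSq, quad, mulVec_inv_mulVec ha, dotProduct_comm]

lemma normSq_nonneg (ha : a.PosDef) (b : Fin n → ℝ) : 0 ≤ normSq a b := by
  rw [normSq_eq_quad ha]; exact quad_nonneg ha _

lemma eq_zero_of_normSq (ha : a.PosDef) (h : normSq a b = 0) : b = 0 := by
  by_contra hb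
  refine (quad_pos ha (v := a⁻¹ *ᵥ b) fun h0 => hb ?_).ne' (by rw [← normSq_eq_quad ha, h])
  rw [← mulVec_inv_mulVec ha b, h0, Matrix.mulVec_zero]

/-- Cauchy–Schwarz for the dual norm: the form is nonnegative on `|b|² v - b(v) a⁻¹b`, which is
`|b|²` times the part of `v` orthogonal to `a⁻¹b`. -/
lemma dotProduct_sq_le (ha : a.PosDef) (b v : Fin n → ℝ) :
    (b ⬝ᵥ v) ^ 2 ≤ normSq a b * quad a v := by
  rcases (normSq_nonneg ha b).eq_or_lt with h | h
  · simp [eq_zero_of_normSq ha h.symm, normSq]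
  · have h1 := quad_nonneg ha (normSq a b • v + (-(b ⬝ᵥ v)) • (a⁻¹ *ᵥ b))
    rw [quad_add ha, quad_smul, quad_smul, ← normSq_eq_quad ha, Matrix.mulVec_smul,
      mulVec_inv_mulVec ha, smul_dotProduct, dotProduct_smul, dotProduct_comm v b] at h1
    simp only [smul_eq_mul] at h1
    nlinarith

lemma exists_ne_zero_dotProduct_eq_zero (hn : 2 ≤ n) (w : Fin n → ℝ) :
    ∃ v : Fin n → ℝ, v ≠ 0 ∧ w ⬝ᵥ v = 0 := by
  let i : Fin n := ⟨0, by omega⟩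
  let j : Fin n := ⟨1, by omega⟩
  have hij : i ≠ j := by simp [i, j]
  by_cases h : w j = 0
  · exact ⟨Pi.single j 1, by simp, by simp [h]⟩
  · refine ⟨Pi.single i (w j) - Pi.single j (w i), fun h0 => h ?_, by
      simp [dotProduct_sub, mul_comm]⟩
    simpa [hij] using congrFun h0 i

lemma exists_quad_eq_one (ha : a.PosDef) (hv : v ≠ 0) :
    ∃ r : ℝ, r ≠ 0 ∧ quad a (r • v) = 1 := by
  have h := quad_pos ha hv
  refine ⟨(√(quad a v))⁻¹, by positivity, ?_⟩
  rw [quad_smul, inv_pow, Real.sq_sqrt h.le, inv_mul_cancel₀ h.ne']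

/-- An orthonormal pair whose first vector is the direction of `b`. -/
lemma exists_orthonormal_pair (hn : 2 ≤ n) (ha : a.PosDef) (b : Fin n → ℝ) :
    ∃ e₁ e₂ : Fin n → ℝ, quad a e₁ = 1 ∧ quad a e₂ = 1 ∧ e₁ ⬝ᵥ a *ᵥ e₂ = 0 ∧
      b ⬝ᵥ e₁ = √(normSq a b) ∧ b ⬝ᵥ e₂ = 0 := by
  -- If `b = 0` it has no direction, and any orthonormal pair serves.
  rcases (normSq_nonneg ha b).eq_or_lt with h | h
  · obtain rfl := eq_zero_of_normSq ha h.symm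
    obtain ⟨v, hv, -⟩ := exists_ne_zero_dotProduct_eq_zero hn 0
    obtain ⟨w, hw, hvw⟩ := exists_ne_zero_dotProduct_eq_zero hn (a *ᵥ v)
    obtain ⟨r, -, hr⟩ := exists_quad_eq_one ha hv
    obtain ⟨q, -, hq⟩ := exists_quad_eq_one ha hw
    refine ⟨r • v, q • w, hr, hq, ?_, by simp [normSq], by simp⟩
    rw [dotProduct_mulVec_symm ha, Matrix.mulVec_smul, smul_dotProduct, dotProduct_smul,
      dotProduct_comm, hvw]
    simp
  · obtain ⟨w, hw, hbw⟩ := exists_ne_zero_dotProduct_eq_zero hn b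
    obtain ⟨q, -, hq⟩ := exists_quad_eq_one ha hw
    have hs := Real.sq_sqrt h.le
    have hs0 : 0 < √(normSq a b) := Real.sqrt_pos.2 h
    refine ⟨(√(normSq a b))⁻¹ • (a⁻¹ *ᵥ b), q • w, ?_, hq, ?_, ?_, by simp [hbw]⟩
    · rw [quad_smul, ← normSq_eq_quad ha, inv_pow, hs, inv_mul_cancel₀ h.ne']
    · rw [dotProduct_mulVec_symm ha, Matrix.mulVec_smul, mulVec_inv_mulVec ha, smul_dotProduct,
        dotProduct_smul, dotProduct_comm, hbw]
      simp
    · rw [dotProduct_smul, ← normSq, smul_eq_mul]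
      field_simp
      exact hs.symm

end

/-! ### Functions of `α` and `s = β / α` on a fibre -/

section

variable {n : ℕ} {a : Matrix (Fin n) (Fin n) ℝ} {b : Fin n → ℝ} {y : Coord n}

lemma ofLp_ne_zero (hy : y ≠ 0) : y.ofLp ≠ 0 := fun h => hy (by ext i; simp [h])

lemma hasGrad_dotProduct (b : Fin n → ℝ) (y : Coord n) :
    HasGrad (fun z => b ⬝ᵥ z.ofLp) b y :=
  (HasGrad.sum (s := Finset.univ) fun j _ => (hasGrad_coord j).const_mul (b j)).congr_grad
    fun i => by simp

lemma hasGrad_quad (ha : a.PosDef) (y : Coord n) :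
    HasGrad (fun z => quad a z.ofLp) (fun i => 2 * (a *ᵥ y.ofLp) i) y := by
  have h : HasGrad (fun z : Coord n => ∑ i, z i * (a i ⬝ᵥ z.ofLp)) _ y :=
    HasGrad.sum (s := Finset.univ) fun j _ => (hasGrad_coord j).mul (hasGrad_dotProduct (a j) y)
  refine h.congr_grad fun i => ?_
  have h1 : ∑ j, y j * a j i = (a *ᵥ y.ofLp) i :=
    Finset.sum_congr rfl fun j _ => by rw [symm_apply ha j i, mul_comm]
  rw [Finset.sum_add_distrib, h1]
  simp [Matrix.mulVec, two_mul]

variable (a) in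
/-- The norm `α`. -/
def alpha (y : Coord n) : ℝ := √(quad a y.ofLp)

variable (a b) in
/-- The quotient `s = β / α`. -/
def ratio (y : Coord n) : ℝ := (b ⬝ᵥ y.ofLp) / alpha a y

lemma alpha_pos (ha : a.PosDef) (hy : y ≠ 0) : 0 < alpha a y :=
  Real.sqrt_pos.2 (quad_pos ha (ofLp_ne_zero hy))

lemma alpha_sq (ha : a.PosDef) (y : Coord n) : alpha a y ^ 2 = quad a y.ofLp :=
  Real.sq_sqrt (quad_nonneg ha _)

lemma ratio_mul_alpha (ha : a.PosDef) (hy : y ≠ 0) : ratio a b y * alpha a y = b ⬝ᵥ y.ofLp :=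
  div_mul_cancel₀ _ (alpha_pos ha hy).ne'

lemma ratio_sq_le (ha : a.PosDef) (hy : y ≠ 0) : ratio a b y ^ 2 ≤ normSq a b := by
  rw [ratio, div_pow, alpha_sq ha, div_le_iff₀ (quad_pos ha (ofLp_ne_zero hy))]
  exact dotProduct_sq_le ha _ _

lemma hasGrad_alpha (ha : a.PosDef) (hy : y ≠ 0) :
    HasGrad (alpha a) (fun i => (a *ᵥ y.ofLp) i / alpha a y) y := by
  have h := quad_pos ha (ofLp_ne_zero hy)
  refine ((hasGrad_quad ha y).scalar_comp (Real.hasDerivAt_sqrt h.ne')).congr_grad fun i => ?_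
  rw [← alpha]
  have := alpha_pos ha hy
  field_simp

lemma hasGrad_ratio (ha : a.PosDef) (hy : y ≠ 0) :
    HasGrad (ratio a b) (fun i => (b i - ratio a b y * (a *ᵥ y.ofLp) i / alpha a y) / alpha a y)
      y := by
  have h := alpha_pos ha hy
  refine ((hasGrad_dotProduct b y).mul ((hasGrad_alpha ha hy).scalar_comp
    (hasDerivAt_inv h.ne'))).congr_grad fun i => ?_
  rw [← ratio_mul_alpha ha hy]
  field_simp
  ring

lemma hasGrad_comp_ratio (ha : a.PosDef) (hy : y ≠ 0) {h : ℝ × ℝ → ℝ} {t : ℝ}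
    (hh : DifferentiableAt ℝ h (t, ratio a b y)) :
    HasGrad (fun z => h (t, ratio a b z)) (fun i => d2 h (t, ratio a b y) *
      ((b i - ratio a b y * (a *ᵥ y.ofLp) i / alpha a y) / alpha a y)) y :=
  ((hasGrad_const t).comp_prod (hasGrad_ratio ha hy) hh).congr_grad fun i => by ring

lemma contDiffAt_dotProduct (b : Fin n → ℝ) (y : Coord n) :
    ContDiffAt ℝ ∞ (fun z : Coord n => b ⬝ᵥ z.ofLp) y := by
  unfold dotProduct; fun_prop

lemma contDiffAt_alpha (ha : a.PosDef) (hy : y ≠ 0) : ContDiffAt ℝ ∞ (alpha a) y := by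
  have h : ContDiffAt ℝ ∞ (fun z : Coord n => quad a z.ofLp) y := by
    unfold quad dotProduct Matrix.mulVec dotProduct; fun_prop
  exact h.sqrt (quad_pos ha (ofLp_ne_zero hy)).ne'

lemma contDiffAt_ratio (ha : a.PosDef) (hy : y ≠ 0) : ContDiffAt ℝ ∞ (ratio a b) y :=
  (contDiffAt_dotProduct b y).div (contDiffAt_alpha ha hy) (alpha_pos ha hy).ne'

lemma contDiffAt_comp_ratio (ha : a.PosDef) (hy : y ≠ 0) {h : ℝ × ℝ → ℝ} {t : ℝ}
    (hh : ContDiffAt ℝ ∞ h (t, ratio a b y)) :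
    ContDiffAt ℝ ∞ (fun z => h (t, ratio a b z)) y :=
  hh.comp y (contDiffAt_const.prodMk (contDiffAt_ratio ha hy))

end

/-! ### The vertical derivatives of `F² = α² φ²` -/

/-- The coefficient `2 φ φ₂`. -/
def coefX (φ : ℝ × ℝ → ℝ) (p : ℝ × ℝ) : ℝ := 2 * φ p * d2 φ p

/-- The coefficient `2 (φ² - s φ φ₂)`. -/
def coefY (φ : ℝ × ℝ → ℝ) (p : ℝ × ℝ) : ℝ := 2 * (φ p ^ 2 - p.2 * φ p * d2 φ p)

/-- The coefficient `4 φ φ₁`. -/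
def coefZ (φ : ℝ × ℝ → ℝ) (p : ℝ × ℝ) : ℝ := 4 * φ p * d1 φ p

section

variable {φ : ℝ × ℝ → ℝ} {p : ℝ × ℝ} {t s : ℝ}

lemma contDiffAt_coefX (h : ContDiffAt ℝ ∞ φ p) : ContDiffAt ℝ ∞ (coefX φ) p :=
  (contDiffAt_const.mul h).mul (contDiffAt_d2 h)

lemma contDiffAt_coefY (h : ContDiffAt ℝ ∞ φ p) : ContDiffAt ℝ ∞ (coefY φ) p :=
  contDiffAt_const.mul ((h.pow 2).sub ((contDiffAt_snd.mul h).mul (contDiffAt_d2 h)))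

lemma contDiffAt_coefZ (h : ContDiffAt ℝ ∞ φ p) : ContDiffAt ℝ ∞ (coefZ φ) p :=
  (contDiffAt_const.mul h).mul (contDiffAt_d1 h)

lemma _root_.ContDiffAt.differentiableAt_infty {E : Type*} [NormedAddCommGroup E]
    [NormedSpace ℝ E] {f : E → ℝ} {x : E} (h : ContDiffAt ℝ ∞ f x) : DifferentiableAt ℝ f x :=
  h.differentiableAt (by simp)

lemma d2_coefX (h : ContDiffAt ℝ ∞ φ (t, s)) : d2 (coefX φ) (t, s) =
    2 * (d2 φ (t, s) ^ 2 + φ (t, s) * d2 (d2 φ) (t, s)) := by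
  refine d2_eq_of_hasDerivAt (contDiffAt_coefX h).differentiableAt_infty ?_
  have h1 := hasDerivAt_d2 h.differentiableAt_infty
  have h2 := hasDerivAt_d2 (contDiffAt_d2 h).differentiableAt_infty
  exact ((h1.const_mul 2).mul h2).congr_deriv (by ring)

lemma d2_coefY (h : ContDiffAt ℝ ∞ φ (t, s)) : d2 (coefY φ) (t, s) =
    2 * (φ (t, s) * d2 φ (t, s) - s * (d2 φ (t, s) ^ 2 + φ (t, s) * d2 (d2 φ) (t, s))) := by
  refine d2_eq_of_hasDerivAt (contDiffAt_coefY h).differentiableAt_infty ?_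
  have h1 := hasDerivAt_d2 h.differentiableAt_infty
  have h2 := hasDerivAt_d2 (contDiffAt_d2 h).differentiableAt_infty
  exact (((h1.pow 2).sub (((hasDerivAt_id s).mul h1).mul h2)).const_mul 2).congr_deriv
    (by simp; ring)

lemma d2_coefZ (h : ContDiffAt ℝ ∞ φ (t, s)) : d2 (coefZ φ) (t, s) =
    4 * (d1 φ (t, s) * d2 φ (t, s) + φ (t, s) * d2 (d1 φ) (t, s)) := by
  refine d2_eq_of_hasDerivAt (contDiffAt_coefZ h).differentiableAt_infty ?_
  have h1 := hasDerivAt_d2 h.differentiableAt_infty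
  have h2 := hasDerivAt_d2 (contDiffAt_d1 h).differentiableAt_infty
  exact ((h1.const_mul 4).mul h2).congr_deriv (by ring)

end

/-- The derivative of `A φ(T, B/√A)²`, for functions `A > 0`, `B`, `T` on coordinate space. -/
lemma hasGrad_sq_metric {n : ℕ} {φ : ℝ × ℝ → ℝ} {A B T : Coord n → ℝ} {wA wB wT : Fin n → ℝ}
    {z : Coord n} (hA : HasGrad A wA z) (hB : HasGrad B wB z) (hT : HasGrad T wT z)
    (h0 : 0 < A z) (hφ : DifferentiableAt ℝ φ (T z, B z / √(A z))) :
    HasGrad (fun u => A u * φ (T u, B u / √(A u)) ^ 2)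
      (fun i => coefY φ (T z, B z / √(A z)) / 2 * wA i
        + √(A z) * coefX φ (T z, B z / √(A z)) * wB i
        + A z * coefZ φ (T z, B z / √(A z)) / 2 * wT i) z := by
  have hs := Real.sqrt_pos.2 h0
  have hS := hB.mul ((hA.scalar_comp (Real.hasDerivAt_sqrt h0.ne')).scalar_comp
    (hasDerivAt_inv hs.ne'))
  have hf := hT.comp_prod hS (by simpa only [div_eq_mul_inv] using hφ)
  refine (hA.mul (hf.mul hf)).congr ?_ |>.congr_grad fun i => ?_
  · exact Filter.Eventually.of_forall fun u => by simp only [div_eq_mul_inv, sq]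
  · simp only [← div_eq_mul_inv, coefX, coefY, coefZ]
    -- With `A = r²` the claim becomes a rational identity in `r` and the first derivatives of `φ`.
    obtain ⟨r, hr⟩ : ∃ r, r = √(A z) := ⟨_, rfl⟩
    have hAr : A z = r ^ 2 := by rw [hr, Real.sq_sqrt h0.le]
    have hr0 : r ≠ 0 := by rw [hr]; exact hs.ne'
    rw [← hr, hAr]
    generalize φ (T z, B z / r) = f
    generalize d1 φ (T z, B z / r) = f1
    generalize d2 φ (T z, B z / r) = f2
    field_simp
    ring

section

variable {n : ℕ} (a : Matrix (Fin n) (Fin n) ℝ) (b : Fin n → ℝ) (φ : ℝ × ℝ → ℝ) (t : ℝ)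

/-- The first vertical derivatives of `F²`. -/
def vert (m : Fin n) (y : Coord n) : ℝ :=
  alpha a y * coefX φ (t, ratio a b y) * b m + coefY φ (t, ratio a b y) * (a *ᵥ y.ofLp) m

/-- The horizontal derivatives of `F²`, divided by the conformal factor. -/
def horiz (k : Fin n) (y : Coord n) : ℝ :=
  alpha a y * coefX φ (t, ratio a b y) * (a *ᵥ y.ofLp) k
    + alpha a y ^ 2 * coefZ φ (t, ratio a b y) * b k

/-- The derivatives of `s = β / α`. -/
def ratioGrad (l : Fin n) (y : Coord n) : ℝ :=
  (b l - ratio a b y * (a *ᵥ y.ofLp) l / alpha a y) / alpha a y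

/-- The second vertical derivatives of `F²`. -/
def vert2 (m l : Fin n) (y : Coord n) : ℝ :=
  ((a *ᵥ y.ofLp) l / alpha a y * coefX φ (t, ratio a b y)
    + alpha a y * (d2 (coefX φ) (t, ratio a b y) * ratioGrad a b l y)) * b m
  + (d2 (coefY φ) (t, ratio a b y) * ratioGrad a b l y * (a *ᵥ y.ofLp) m
    + coefY φ (t, ratio a b y) * a m l)

/-- The vertical derivatives of `horiz`. -/
def horiz2 (k l : Fin n) (y : Coord n) : ℝ :=
  ((a *ᵥ y.ofLp) l / alpha a y * coefX φ (t, ratio a b y)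
    + alpha a y * (d2 (coefX φ) (t, ratio a b y) * ratioGrad a b l y)) * (a *ᵥ y.ofLp) k
  + alpha a y * coefX φ (t, ratio a b y) * a k l
  + (2 * (a *ᵥ y.ofLp) l * coefZ φ (t, ratio a b y)
    + alpha a y ^ 2 * (d2 (coefZ φ) (t, ratio a b y) * ratioGrad a b l y)) * b k

variable {a b φ t} {y : Coord n}

lemma hasGrad_vert (ha : a.PosDef) (hy : y ≠ 0) (hφ : ContDiffAt ℝ ∞ φ (t, ratio a b y))
    (m : Fin n) : HasGrad (vert a b φ t m) (fun l => vert2 a b φ t m l y) y := by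
  have hX := hasGrad_comp_ratio ha hy (contDiffAt_coefX hφ).differentiableAt_infty
  have hY := hasGrad_comp_ratio ha hy (contDiffAt_coefY hφ).differentiableAt_infty
  refine (((hasGrad_alpha ha hy).mul hX).mul (hasGrad_const (b m))).add
    (hY.mul (hasGrad_dotProduct (a m) y)) |>.congr_grad fun l => ?_
  simp only [vert2, ratioGrad]
  have : a m ⬝ᵥ y.ofLp = (a *ᵥ y.ofLp) m := rfl
  rw [this]
  ring

lemma hasGrad_horiz (ha : a.PosDef) (hy : y ≠ 0) (hφ : ContDiffAt ℝ ∞ φ (t, ratio a b y))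
    (k : Fin n) : HasGrad (horiz a b φ t k) (fun l => horiz2 a b φ t k l y) y := by
  have hX := hasGrad_comp_ratio ha hy (contDiffAt_coefX hφ).differentiableAt_infty
  have hZ := hasGrad_comp_ratio ha hy (contDiffAt_coefZ hφ).differentiableAt_infty
  have hα := hasGrad_alpha ha hy
  have h0 := alpha_pos ha hy
  refine ((hα.mul hX).mul (hasGrad_dotProduct (a k) y)).add
    (((hα.mul hα).mul hZ).mul (hasGrad_const (b k)))
    |>.congr (Filter.Eventually.of_forall fun z => ?_) |>.congr_grad fun l => ?_
  · rw [horiz, sq]; rfl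
  · simp only [horiz2, ratioGrad]
    have : a k ⬝ᵥ y.ofLp = (a *ᵥ y.ofLp) k := rfl
    rw [this]
    field_simp
    ring

/-- The closed formula is not visibly symmetric; inserting the `s`-derivatives of the coefficients
makes the mixed terms agree. This allows contraction over either index. -/
lemma vert2_symm (ha : a.PosDef) (hy : y ≠ 0) (hφ : ContDiffAt ℝ ∞ φ (t, ratio a b y))
    (m l : Fin n) : vert2 a b φ t m l y = vert2 a b φ t l m y := by
  have h0 := alpha_pos ha hy
  simp only [vert2, ratioGrad, d2_coefX hφ, d2_coefY hφ, coefX, coefY, symm_apply ha m l]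
  field_simp
  ring

lemma mulVec_apply_eq_sum (ha : a.PosDef) (v : Fin n → ℝ) (l : Fin n) :
    (a *ᵥ v) l = ∑ m, a m l * v m := by
  simp only [Matrix.mulVec, dotProduct]
  exact Finset.sum_congr rfl fun m _ => by rw [symm_apply ha m l]

/-- The contraction of the second vertical derivatives with a vector. -/
lemma sum_vert2_mul (ha : a.PosDef) (v : Fin n → ℝ) (l : Fin n) :
    ∑ m, vert2 a b φ t m l y * v m =
      ((a *ᵥ y.ofLp) l / alpha a y * coefX φ (t, ratio a b y)
        + alpha a y * (d2 (coefX φ) (t, ratio a b y) * ratioGrad a b l y)) * (b ⬝ᵥ v)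
      + (d2 (coefY φ) (t, ratio a b y) * ratioGrad a b l y * (v ⬝ᵥ a *ᵥ y.ofLp)
        + coefY φ (t, ratio a b y) * (a *ᵥ v) l) := by
  have h1 := mulVec_apply_eq_sum ha v l
  rw [h1]
  simp only [dotProduct, Finset.mul_sum, ← Finset.sum_add_distrib]
  refine Finset.sum_congr rfl fun m _ => ?_
  rw [vert2]
  ring

lemma sum_horiz2_mul (ha : a.PosDef) (v : Fin n → ℝ) (l : Fin n) :
    ∑ k, horiz2 a b φ t k l y * v k =
      ((a *ᵥ y.ofLp) l / alpha a y * coefX φ (t, ratio a b y)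
        + alpha a y * (d2 (coefX φ) (t, ratio a b y) * ratioGrad a b l y)) * (v ⬝ᵥ a *ᵥ y.ofLp)
      + alpha a y * coefX φ (t, ratio a b y) * (a *ᵥ v) l
      + (2 * (a *ᵥ y.ofLp) l * coefZ φ (t, ratio a b y)
        + alpha a y ^ 2 * (d2 (coefZ φ) (t, ratio a b y) * ratioGrad a b l y)) * (b ⬝ᵥ v) := by
  have h1 := mulVec_apply_eq_sum ha v l
  rw [h1]
  simp only [dotProduct, Finset.mul_sum, ← Finset.sum_add_distrib]
  refine Finset.sum_congr rfl fun m _ => ?_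
  rw [horiz2]
  ring

variable (φ) in
/-- The coefficient `E` of the part `c α E yⁱ` of the spray proportional to `y`. -/
def projFactor (p : ℝ × ℝ) : ℝ :=
  (d2 φ p / 2 + p.2 * d1 φ p - Hfun φ p * (p.2 * φ p + (p.1 - p.2 ^ 2) * d2 φ p)) / φ p

/-- The equation `2 g_{lm} (P yᵐ + α² H bᵐ) = ½ (yᵏ ∂_l D_k - D_l)` that determines the spray. -/
lemma sum_vert2_spray (ha : a.PosDef) (hy : y ≠ 0)
    (hφ : ContDiffAt ℝ ∞ φ (normSq a b, ratio a b y)) (h0 : φ (normSq a b, ratio a b y) ≠ 0)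
    (hd : pdeDen φ (normSq a b, ratio a b y) ≠ 0) (l : Fin n) :
    ∑ m, vert2 a b φ (normSq a b) m l y * (2 *
      (alpha a y * projFactor φ (normSq a b, ratio a b y) * y m
        + alpha a y ^ 2 * Hfun φ (normSq a b, ratio a b y) * (a⁻¹ *ᵥ b) m)) =
      ∑ k, horiz2 a b φ (normSq a b) k l y * y k - horiz a b φ (normSq a b) l y := by
  have hα := (alpha_pos ha hy).ne'
  have hB := ratio_mul_alpha (b := b) ha hy
  have hA := alpha_sq ha y
  have e : ∀ m, vert2 a b φ (normSq a b) m l y * (2 *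
      (alpha a y * projFactor φ (normSq a b, ratio a b y) * y m
        + alpha a y ^ 2 * Hfun φ (normSq a b, ratio a b y) * (a⁻¹ *ᵥ b) m)) =
      2 * alpha a y * projFactor φ (normSq a b, ratio a b y) *
        (vert2 a b φ (normSq a b) m l y * y m) +
      2 * alpha a y ^ 2 * Hfun φ (normSq a b, ratio a b y) *
        (vert2 a b φ (normSq a b) m l y * (a⁻¹ *ᵥ b) m) := fun m => by ring
  simp only [e, Finset.sum_add_distrib, ← Finset.mul_sum]
  -- All contractions reduce to `α`, `s`, `b²`, the two covector components at `l` and derivatives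
  -- of `φ`; what remains is a rational identity in these.
  rw [sum_vert2_mul ha, sum_vert2_mul ha, sum_horiz2_mul ha, mulVec_inv_mulVec ha,
    dotProduct_mulVec_symm ha (a⁻¹ *ᵥ b), mulVec_inv_mulVec ha, dotProduct_comm y.ofLp b, ← hB,
    ← normSq, ← quad, ← hA]
  simp only [horiz, ratioGrad, d2_coefX hφ, d2_coefY hφ, d2_coefZ hφ, coefX, coefY, coefZ,
    projFactor, Hfun]
  have hd' : pdeDen φ (normSq a b, ratio a b y) = φ (normSq a b, ratio a b y)
    - ratio a b y * d2 φ (normSq a b, ratio a b y) + (normSq a b - ratio a b y ^ 2) *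
      d2 (d2 φ) (normSq a b, ratio a b y) := rfl
  have hn' : pdeNum φ (normSq a b, ratio a b y) = d2 (d2 φ) (normSq a b, ratio a b y)
    - 2 * (d1 φ (normSq a b, ratio a b y) - ratio a b y *
      d2 (d1 φ) (normSq a b, ratio a b y)) := rfl
  rw [hn']
  -- The denominator stays an atom while fractions are cleared and is expanded only afterwards.
  obtain ⟨D, hD⟩ : ∃ D, D = pdeDen φ (normSq a b, ratio a b y) := ⟨_, rfl⟩
  rw [← hD] at hd hd' ⊢
  generalize normSq a b = t at *
  generalize ratio a b y = s at *
  generalize (a *ᵥ y.ofLp) l = L at *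
  generalize alpha a y = r at *
  generalize φ (t, s) = f at *
  generalize d1 φ (t, s) = f1 at *
  generalize d2 φ (t, s) = f2 at *
  generalize d2 (d1 φ) (t, s) = f12 at *
  generalize d2 (d2 φ) (t, s) = f22 at *
  generalize b l = bl at *
  clear hA hB hD e hφ hn'
  field_simp
  rw [hd']
  ring

end

/-! ### The spray in a chart -/

/-- On the open set `Ω` of `ℝⁿ`, `a` is a Riemannian metric and `b` a 1-form with
`b_{i|j} = c a_{ij}`. -/
structure IsConformalPair {n : ℕ} (a : Coord n → Matrix (Fin n) (Fin n) ℝ)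
    (b : Coord n → Fin n → ℝ) (c : Coord n → ℝ) (Ω : Set (Coord n)) : Prop where
  isOpen : IsOpen Ω
  contDiffAt_metric : ∀ u ∈ Ω, ∀ i j, ContDiffAt ℝ ∞ (fun u' => a u' i j) u
  contDiffAt_form : ∀ u ∈ Ω, ∀ i, ContDiffAt ℝ ∞ (fun u' => b u' i) u
  posDef : ∀ u ∈ Ω, (a u).PosDef
  covDeriv_eq : ∀ u ∈ Ω, ∀ i j, covDeriv a b i j u = c u * a u i j

/-- The coefficients `Nᵐ_k = Γᵐ_{kj} yʲ`. -/
def conn {n : ℕ} (a : Coord n → Matrix (Fin n) (Fin n) ℝ) (u : Coord n) (m k : Fin n)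
    (y : Fin n → ℝ) : ℝ :=
  ∑ j, christoffel a m k j u * y j

/-- The metric `α φ(b², β/α)` in coordinates. -/
def localMetric {n : ℕ} (a : Coord n → Matrix (Fin n) (Fin n) ℝ) (b : Coord n → Fin n → ℝ)
    (φ : ℝ × ℝ → ℝ) (u y : Coord n) : ℝ :=
  alpha (a u) y * φ (normSq (a u) (b u), ratio (a u) (b u) y)

namespace IsConformalPair

variable {n : ℕ} {a : Coord n → Matrix (Fin n) (Fin n) ℝ} {b : Coord n → Fin n → ℝ}
  {c : Coord n → ℝ} {Ω : Set (Coord n)} {u : Coord n}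

lemma eventually_mem (hM : IsConformalPair a b c Ω) (hu : u ∈ Ω) : ∀ᶠ z in nhds u, z ∈ Ω :=
  hM.isOpen.mem_nhds hu

lemma hasGrad_metric (hM : IsConformalPair a b c Ω) (hu : u ∈ Ω) (i j : Fin n) :
    HasGrad (fun u' => a u' i j) (fun k => pd (fun u' => a u' i j) k u) u :=
  (hM.contDiffAt_metric u hu i j).differentiableAt_infty.hasGrad

lemma hasGrad_form (hM : IsConformalPair a b c Ω) (hu : u ∈ Ω) (i : Fin n) :
    HasGrad (fun u' => b u' i) (fun k => pd (fun u' => b u' i) k u) u :=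
  (hM.contDiffAt_form u hu i).differentiableAt_infty.hasGrad

lemma pd_metric_symm (hM : IsConformalPair a b c Ω) (hu : u ∈ Ω) (i j k : Fin n) :
    pd (fun u' => a u' i j) k u = pd (fun u' => a u' j i) k u :=
  pd_congr ((hM.eventually_mem hu).mono fun z hz => symm_apply (hM.posDef z hz) i j) k

lemma sum_metric_mul_christoffel (hM : IsConformalPair a b c Ω) (hu : u ∈ Ω) (m i j : Fin n) :
    ∑ k, a u m k * christoffel a k i j u = (1 / 2) * (pd (fun u' => a u' j m) i u
      + pd (fun u' => a u' i m) j u - pd (fun u' => a u' i j) m u) := by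
  have h := congrFun (mulVec_inv_mulVec (hM.posDef u hu) fun l =>
    pd (fun u' => a u' j l) i u + pd (fun u' => a u' i l) j u - pd (fun u' => a u' i j) l u) m
  simp only [Matrix.mulVec, dotProduct] at h
  rw [← h, Finset.mul_sum]
  refine Finset.sum_congr rfl fun k _ => ?_
  rw [christoffel]
  ring

lemma christoffel_symm (hM : IsConformalPair a b c Ω) (hu : u ∈ Ω) (k i j : Fin n) :
    christoffel a k i j u = christoffel a k j i u := by
  rw [christoffel, christoffel]
  congr 1
  refine Finset.sum_congr rfl fun l _ => ?_
  rw [hM.pd_metric_symm hu i j l]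
  ring

/-- The Levi-Civita connection preserves the metric: in the sum of the two lowered Christoffel
symbols all derivatives but `∂_k a_{ij}` cancel. -/
lemma pd_metric (hM : IsConformalPair a b c Ω) (hu : u ∈ Ω) (i j k : Fin n) :
    pd (fun u' => a u' i j) k u =
      ∑ m, a u i m * christoffel a m k j u + ∑ m, a u j m * christoffel a m k i u := by
  rw [hM.sum_metric_mul_christoffel hu, hM.sum_metric_mul_christoffel hu,
    hM.pd_metric_symm hu j i k, hM.pd_metric_symm hu k i j, hM.pd_metric_symm hu k j i]
  ring

lemma pd_form (hM : IsConformalPair a b c Ω) (hu : u ∈ Ω) (i k : Fin n) :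
    pd (fun u' => b u' i) k u = c u * a u i k + ∑ m, christoffel a m k i u * b u m := by
  have h := hM.covDeriv_eq u hu i k
  rw [covDeriv, sub_eq_iff_eq_add] at h
  rw [h]
  congr 1
  exact Finset.sum_congr rfl fun m _ => by rw [hM.christoffel_symm hu]

lemma sum_mul_christoffel (w y : Fin n → ℝ) (k : Fin n) :
    ∑ i, y i * ∑ m, w m * christoffel a m k i u = ∑ m, w m * conn a u m k y := by
  simp only [conn, Finset.mul_sum]
  rw [Finset.sum_comm]
  exact Finset.sum_congr rfl fun m _ => Finset.sum_congr rfl fun i _ => by ring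

lemma sum_pd_metric (hM : IsConformalPair a b c Ω) (hu : u ∈ Ω) (y : Fin n → ℝ) (k : Fin n) :
    ∑ i, y i * ∑ j, y j * pd (fun u' => a u' i j) k u =
      2 * ∑ m, conn a u m k y * (a u *ᵥ y) m := by
  have h1 : ∑ i, y i * ∑ j, y j * ∑ m, a u i m * christoffel a m k j u =
      ∑ m, conn a u m k y * (a u *ᵥ y) m := by
    simp only [sum_mul_christoffel]
    exact dotProduct_mulVec_symm (hM.posDef u hu) y fun m => conn a u m k y
  have h2 : ∑ i, y i * ∑ j, y j * ∑ m, a u j m * christoffel a m k i u =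
      ∑ i, y i * ∑ j, y j * ∑ m, a u i m * christoffel a m k j u := by
    simp only [Finset.mul_sum]
    rw [Finset.sum_comm]
    exact Finset.sum_congr rfl fun i _ => Finset.sum_congr rfl fun j _ =>
      Finset.sum_congr rfl fun m _ => by ring
  simp only [hM.pd_metric hu, mul_add, Finset.sum_add_distrib]
  rw [h2, h1, two_mul]

lemma sum_pd_form (hM : IsConformalPair a b c Ω) (hu : u ∈ Ω) (y : Fin n → ℝ) (k : Fin n) :
    ∑ i, y i * pd (fun u' => b u' i) k u =
      c u * (a u *ᵥ y) k + ∑ m, conn a u m k y * b u m := by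
  have h1 := sum_mul_christoffel (a := a) (u := u) (b u) y k
  simp only [mul_comm (b u _)] at h1
  simp only [hM.pd_form hu, mul_add, Finset.sum_add_distrib]
  rw [h1]
  congr 1
  rw [Matrix.mulVec, dotProduct, Finset.mul_sum]
  exact Finset.sum_congr rfl fun i _ => by rw [symm_apply (hM.posDef u hu) i k]; ring

lemma hasGrad_quad_base (hM : IsConformalPair a b c Ω) (hu : u ∈ Ω) (y : Fin n → ℝ) :
    HasGrad (fun u' => quad (a u') y)
      (fun k => 2 * ∑ m, conn a u m k y * (a u *ᵥ y) m) u := by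
  have h : HasGrad (fun u' => ∑ i, y i * ∑ j, y j * a u' i j) _ u :=
    HasGrad.sum (s := Finset.univ) fun i _ => HasGrad.const_mul (y i) <|
      HasGrad.sum (s := Finset.univ) fun j _ => (hM.hasGrad_metric hu i j).const_mul (y j)
  refine h.congr (Filter.Eventually.of_forall fun z => ?_) |>.congr_grad fun k =>
    hM.sum_pd_metric hu y k
  simp only [quad, dotProduct, Matrix.mulVec, mul_comm]

lemma hasGrad_dotProduct_base (hM : IsConformalPair a b c Ω) (hu : u ∈ Ω) (y : Fin n → ℝ) :
    HasGrad (fun u' => b u' ⬝ᵥ y)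
      (fun k => c u * (a u *ᵥ y) k + ∑ m, conn a u m k y * b u m) u := by
  have h : HasGrad (fun u' => ∑ i, y i * b u' i) _ u :=
    HasGrad.sum (s := Finset.univ) fun i _ => (hM.hasGrad_form hu i).const_mul (y i)
  refine h.congr (Filter.Eventually.of_forall fun z => ?_) |>.congr_grad fun k =>
    hM.sum_pd_form hu y k
  simp only [dotProduct, mul_comm]

lemma _root_.contDiffAt_matrix_det {m : ℕ} {E : Type*} [NormedAddCommGroup E] [NormedSpace ℝ E]
    {A : E → Matrix (Fin m) (Fin m) ℝ} {x : E}
    (hA : ∀ i j, ContDiffAt ℝ ∞ (fun z => A z i j) x) :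
    ContDiffAt ℝ ∞ (fun z => (A z).det) x := by
  simp only [Matrix.det_apply]
  exact ContDiffAt.sum fun σ _ => (contDiffAt_prod fun i _ => hA _ _).const_smul _

lemma contDiffAt_inv (hM : IsConformalPair a b c Ω) (hu : u ∈ Ω) (i j : Fin n) :
    ContDiffAt ℝ ∞ (fun u' => (a u')⁻¹ i j) u := by
  have h0 := (hM.posDef u hu).det_pos.ne'
  simp only [Matrix.inv_def, Matrix.smul_apply, Ring.inverse_eq_inv', smul_eq_mul,
    Matrix.adjugate_apply]
  refine ((contDiffAt_matrix_det (hM.contDiffAt_metric u hu)).inv h0).mul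
    (contDiffAt_matrix_det fun k l => ?_)
  simp only [Matrix.updateRow_apply]
  split_ifs
  · exact contDiffAt_const
  · exact hM.contDiffAt_metric u hu k l

lemma contDiffAt_dual (hM : IsConformalPair a b c Ω) (hu : u ∈ Ω) (i : Fin n) :
    ContDiffAt ℝ ∞ (fun u' => ((a u')⁻¹ *ᵥ b u') i) u := by
  simp only [Matrix.mulVec, dotProduct]
  exact ContDiffAt.sum fun j _ => (hM.contDiffAt_inv hu i j).mul (hM.contDiffAt_form u hu j)

lemma contDiffAt_normSq (hM : IsConformalPair a b c Ω) (hu : u ∈ Ω) :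
    ContDiffAt ℝ ∞ (fun u' => normSq (a u') (b u')) u := by
  simp only [normSq, dotProduct]
  exact ContDiffAt.sum fun j _ => (hM.contDiffAt_form u hu j).mul (hM.contDiffAt_dual hu j)

/-- The derivative of `b²` is `2 c b_k`. -/
lemma hasGrad_normSq (hM : IsConformalPair a b c Ω) (hu : u ∈ Ω) :
    HasGrad (fun u' => normSq (a u') (b u')) (fun k => 2 * c u * b u k) u := by
  have ha := hM.posDef u hu
  have hx := fun j => (hM.contDiffAt_dual hu j).differentiableAt_infty.hasGrad
  obtain ⟨x, hxu⟩ : ∃ x, x = (a u)⁻¹ *ᵥ b u := ⟨_, rfl⟩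
  have hax : a u *ᵥ x = b u := by rw [hxu, mulVec_inv_mulVec ha]
  have h1 : HasGrad (fun u' => ∑ i, b u' i * ((a u')⁻¹ *ᵥ b u') i) _ u :=
    HasGrad.sum (s := Finset.univ) fun i _ => (hM.hasGrad_form hu i).mul (hx i)
  refine h1.congr_grad fun k => ?_
  -- Differentiating `a x = b`, where `x = a⁻¹b`, avoids any formula for the derivative of the
  -- inverse. Pairing with `x` then gives `∂(b·x) = 2 x·∂b - x·(∂a)x`, in which the connection terms
  -- cancel.
  have h2 : ∀ i, pd (fun u' => b u' i) k u = ∑ j, (pd (fun u' => a u' i j) k u * x j +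
      a u i j * pd (fun u' => ((a u')⁻¹ *ᵥ b u') j) k u) := fun i => by
    have h3 : HasGrad (fun u' => ∑ j, a u' i j * ((a u')⁻¹ *ᵥ b u') j) _ u :=
      HasGrad.sum (s := Finset.univ) fun j _ => (hM.hasGrad_metric hu i j).mul (hx j)
    rw [hxu, ← h3.pd k]
    exact pd_congr ((hM.eventually_mem hu).mono fun z hz =>
      (congrFun (mulVec_inv_mulVec (hM.posDef z hz) (b z)) i).symm) k
  have h4 : ∑ i, x i * pd (fun u' => b u' i) k u =
      ∑ i, x i * ∑ j, x j * pd (fun u' => a u' i j) k u +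
      ∑ j, b u j * pd (fun u' => ((a u')⁻¹ *ᵥ b u') j) k u := by
    have h5 : ∀ j, b u j = ∑ i, x i * a u i j := fun j => by
      rw [← congrFun hax j, mulVec_apply_eq_sum ha]
      exact Finset.sum_congr rfl fun i _ => mul_comm _ _
    simp only [h2, h5, Finset.sum_add_distrib, mul_add, Finset.mul_sum, Finset.sum_mul]
    congr 1
    · exact Finset.sum_congr rfl fun i _ => Finset.sum_congr rfl fun j _ => by ring
    · rw [Finset.sum_comm]
      exact Finset.sum_congr rfl fun i _ => Finset.sum_congr rfl fun j _ => by ring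
  have h6 := hM.sum_pd_metric hu x k
  have h7 := hM.sum_pd_form hu x k
  rw [hax] at h6 h7
  rw [Finset.sum_add_distrib, ← hxu]
  simp only [mul_comm _ (x _)]
  linarith

end IsConformalPair

/-! ### Derivatives of `F²` and the spray of the metric -/

namespace IsConformalPair

variable {n : ℕ} {a : Coord n → Matrix (Fin n) (Fin n) ℝ} {b : Coord n → Fin n → ℝ}
  {c : Coord n → ℝ} {Ω : Set (Coord n)} {u y : Coord n} {φ : ℝ × ℝ → ℝ}
  {L : Coord n → Coord n → ℝ}

lemma sq_eq (hM : IsConformalPair a b c Ω) (hL : ∀ u ∈ Ω, ∀ y, L u y = localMetric a b φ u y)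
    (hu : u ∈ Ω) (y : Coord n) :
    L u y ^ 2 = quad (a u) y.ofLp *
      φ (normSq (a u) (b u), (b u ⬝ᵥ y.ofLp) / √(quad (a u) y.ofLp)) ^ 2 := by
  rw [hL u hu, localMetric, mul_pow, alpha_sq (hM.posDef u hu), ratio, alpha]

lemma pd_sq_fibre (hM : IsConformalPair a b c Ω)
    (hL : ∀ u ∈ Ω, ∀ y, L u y = localMetric a b φ u y) (hu : u ∈ Ω) (hy : y ≠ 0)
    (hφ : ContDiffAt ℝ ∞ φ (normSq (a u) (b u), ratio (a u) (b u) y)) (i : Fin n) :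
    pd (fun z => L u z ^ 2) i y = vert (a u) (b u) φ (normSq (a u) (b u)) i y := by
  have ha := hM.posDef u hu
  have h := hasGrad_sq_metric (φ := φ) (hasGrad_quad ha y) (hasGrad_dotProduct (b u) y)
    (hasGrad_const (normSq (a u) (b u))) (quad_pos ha (ofLp_ne_zero hy))
    hφ.differentiableAt_infty
  simp only [hM.sq_eq hL hu]
  rw [h.pd, vert, ratio, alpha]
  ring

lemma fundamentalTensor_eq (hM : IsConformalPair a b c Ω)
    (hL : ∀ u ∈ Ω, ∀ y, L u y = localMetric a b φ u y) (hu : u ∈ Ω)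
    (hφ : ∀ s : ℝ, s ^ 2 ≤ normSq (a u) (b u) → ContDiffAt ℝ ∞ φ (normSq (a u) (b u), s))
    (hy : y ≠ 0) (i j : Fin n) :
    fundamentalTensor L u y i j = vert2 (a u) (b u) φ (normSq (a u) (b u)) i j y / 2 := by
  have ha := hM.posDef u hu
  have h1 : ∀ᶠ z in nhds y, pd (fun z' => L u z' ^ 2) i z =
      vert (a u) (b u) φ (normSq (a u) (b u)) i z :=
    (isOpen_ne.eventually_mem hy).mono fun z hz => hM.pd_sq_fibre hL hu hz (hφ _ (ratio_sq_le ha hz)) i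
  rw [fundamentalTensor, Matrix.of_apply, pd_congr h1,
    (hasGrad_vert ha hy (hφ _ (ratio_sq_le ha hy)) i).pd]
  ring

lemma fundamentalTensor_mulVec (hM : IsConformalPair a b c Ω)
    (hL : ∀ u ∈ Ω, ∀ y, L u y = localMetric a b φ u y) (hu : u ∈ Ω)
    (hφ : ∀ s : ℝ, s ^ 2 ≤ normSq (a u) (b u) → ContDiffAt ℝ ∞ φ (normSq (a u) (b u), s))
    (hy : y ≠ 0) (v : Fin n → ℝ) (l : Fin n) :
    (fundamentalTensor L u y *ᵥ v) l =
      (∑ m, vert2 (a u) (b u) φ (normSq (a u) (b u)) m l y * v m) / 2 := by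
  have ha := hM.posDef u hu
  rw [Finset.sum_div, Matrix.mulVec, dotProduct]
  refine Finset.sum_congr rfl fun m _ => ?_
  rw [hM.fundamentalTensor_eq hL hu hφ hy, vert2_symm ha hy (hφ _ (ratio_sq_le ha hy))]
  ring

/-- Base derivatives of `α²` and `β` equal their fibre derivatives along `Nᵐ_k`, up to the term `c
a_{ik} yⁱ` for `β`, and `b²` has gradient `2 c b_k`. The chain rule therefore separates a connection
part from `c` times `horiz`. -/
lemma pd_sq_base (hM : IsConformalPair a b c Ω)
    (hL : ∀ u ∈ Ω, ∀ y, L u y = localMetric a b φ u y) (hu : u ∈ Ω) (hy : y ≠ 0)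
    (hφ : ContDiffAt ℝ ∞ φ (normSq (a u) (b u), ratio (a u) (b u) y)) (k : Fin n) :
    pd (fun u' => L u' y ^ 2) k u =
      ∑ m, conn a u m k y.ofLp * vert (a u) (b u) φ (normSq (a u) (b u)) m y
        + c u * horiz (a u) (b u) φ (normSq (a u) (b u)) k y := by
  have ha := hM.posDef u hu
  have h := hasGrad_sq_metric (φ := φ) (hM.hasGrad_quad_base hu y.ofLp)
    (hM.hasGrad_dotProduct_base hu y.ofLp) (hM.hasGrad_normSq hu)
    (quad_pos ha (ofLp_ne_zero hy)) hφ.differentiableAt_infty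
  rw [pd_congr ((hM.eventually_mem hu).mono fun z hz => hM.sq_eq hL hz y), h.pd]
  simp only [vert, horiz, mul_add, Finset.sum_add_distrib]
  rw [alpha_sq ha, ratio, alpha]
  have e1 : ∀ r : ℝ, ∑ m, conn a u m k y.ofLp * (r * b u m) =
      r * ∑ m, conn a u m k y.ofLp * b u m := fun r => by
    rw [Finset.mul_sum]; exact Finset.sum_congr rfl fun m _ => by ring
  have e2 : ∀ r : ℝ, ∑ m, conn a u m k y.ofLp * (r * (a u *ᵥ y.ofLp) m) =
      r * ∑ m, conn a u m k y.ofLp * (a u *ᵥ y.ofLp) m := fun r => by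
    rw [Finset.mul_sum]; exact Finset.sum_congr rfl fun m _ => by ring
  rw [e1, e2]
  ring

lemma hasGrad_conn (m k : Fin n) :
    HasGrad (fun z : Coord n => conn a u m k z.ofLp) (fun l => christoffel a m k l u) y :=
  hasGrad_dotProduct (fun j => christoffel a m k j u) y

lemma sum_conn_mul (hM : IsConformalPair a b c Ω) (hu : u ∈ Ω) (y : Fin n → ℝ) (m l : Fin n) :
    ∑ k, christoffel a m k l u * y k = conn a u m l y :=
  Finset.sum_congr rfl fun k _ => by rw [hM.christoffel_symm hu]

/-- The spray of `α φ(b², β/α)`. -/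
lemma sprayCoeff_eq (hM : IsConformalPair a b c Ω)
    (hL : ∀ u ∈ Ω, ∀ y, L u y = localMetric a b φ u y) (hu : u ∈ Ω)
    (hφ : ∀ s : ℝ, s ^ 2 ≤ normSq (a u) (b u) → ContDiffAt ℝ ∞ φ (normSq (a u) (b u), s))
    (h0 : ∀ s : ℝ, s ^ 2 ≤ normSq (a u) (b u) → φ (normSq (a u) (b u), s) ≠ 0)
    (hd : ∀ s : ℝ, s ^ 2 ≤ normSq (a u) (b u) → pdeDen φ (normSq (a u) (b u), s) ≠ 0)
    (hg : (fundamentalTensor L u y).PosDef) (hy : y ≠ 0) (i : Fin n) :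
    sprayCoeff L i u y = (∑ k, conn a u i k y.ofLp * y k) / 2 +
      c u * (alpha (a u) y * projFactor φ (normSq (a u) (b u), ratio (a u) (b u) y) * y i
        + alpha (a u) y ^ 2 * Hfun φ (normSq (a u) (b u), ratio (a u) (b u) y) *
          ((a u)⁻¹ *ᵥ b u) i) := by
  have ha := hM.posDef u hu
  have hs := ratio_sq_le (b := b u) ha hy
  -- The fundamental tensor is never inverted explicitly: the candidate `G` is shown to solve the
  -- linear system defining the spray, and the inverse is applied at the end.
  obtain ⟨G, hG⟩ : ∃ G : Fin n → ℝ, G = fun i => (∑ k, conn a u i k y.ofLp * y k) / 2 +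
      c u * (alpha (a u) y * projFactor φ (normSq (a u) (b u), ratio (a u) (b u) y) * y i
        + alpha (a u) y ^ 2 * Hfun φ (normSq (a u) (b u), ratio (a u) (b u) y) *
          ((a u)⁻¹ *ᵥ b u) i) := ⟨_, rfl⟩
  have key : ∀ l, (∑ k, pd (fun y' => pd (fun u' => L u' y' ^ 2) k u) l y * y k)
      - pd (fun u' => L u' y ^ 2) l u = 4 * (fundamentalTensor L u y *ᵥ G) l := by
    intro l
    have h1 : ∀ k, pd (fun y' => pd (fun u' => L u' y' ^ 2) k u) l y =
        (∑ m, (christoffel a m k l u * vert (a u) (b u) φ (normSq (a u) (b u)) m y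
          + conn a u m k y.ofLp * vert2 (a u) (b u) φ (normSq (a u) (b u)) m l y))
        + c u * horiz2 (a u) (b u) φ (normSq (a u) (b u)) k l y := fun k => by
      have h2 : ∀ᶠ z in nhds y, pd (fun u' => L u' z ^ 2) k u =
          ∑ m, conn a u m k z.ofLp * vert (a u) (b u) φ (normSq (a u) (b u)) m z
          + c u * horiz (a u) (b u) φ (normSq (a u) (b u)) k z :=
        (isOpen_ne.eventually_mem hy).mono fun z hz =>
          hM.pd_sq_base hL hu hz (hφ _ (ratio_sq_le ha hz)) k
      rw [pd_congr h2]
      exact ((HasGrad.sum (s := Finset.univ) fun m _ => (hasGrad_conn m k).mul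
        (hasGrad_vert ha hy (hφ _ hs) m)).add
        ((hasGrad_horiz ha hy (hφ _ hs) k).const_mul (c u))).pd l
    -- Since `Γᵐ_{kl} yᵏ = Nᵐ_l`, the first sum on the right cancels against the connection part of
    -- `[F²]_{xˡ}`.
    have h3 : ∑ k, (∑ m, (christoffel a m k l u * vert (a u) (b u) φ (normSq (a u) (b u)) m y
          + conn a u m k y.ofLp * vert2 (a u) (b u) φ (normSq (a u) (b u)) m l y)) * y k =
        ∑ m, conn a u m l y.ofLp * vert (a u) (b u) φ (normSq (a u) (b u)) m y +
        ∑ m, vert2 (a u) (b u) φ (normSq (a u) (b u)) m l y *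
          ∑ k, conn a u m k y.ofLp * y k := by
      simp only [← hM.sum_conn_mul hu y.ofLp _ l, Finset.sum_mul, Finset.mul_sum,
        ← Finset.sum_add_distrib]
      rw [Finset.sum_comm]
      exact Finset.sum_congr rfl fun m _ => Finset.sum_congr rfl fun k _ => by ring
    have h4 : (fundamentalTensor L u y *ᵥ G) l =
        (∑ m, vert2 (a u) (b u) φ (normSq (a u) (b u)) m l y * G m) / 2 :=
      hM.fundamentalTensor_mulVec hL hu hφ hy G l
    have h5 := sum_vert2_spray ha hy (hφ _ hs) (h0 _ hs) (hd _ hs) l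
    have h6 : 4 * (fundamentalTensor L u y *ᵥ G) l =
        ∑ m, vert2 (a u) (b u) φ (normSq (a u) (b u)) m l y *
          ∑ k, conn a u m k y.ofLp * y k +
        c u * (∑ k, horiz2 (a u) (b u) φ (normSq (a u) (b u)) k l y * y k -
          horiz (a u) (b u) φ (normSq (a u) (b u)) l y) := by
      rw [← h5, h4, Finset.sum_div, Finset.mul_sum, Finset.mul_sum, ← Finset.sum_add_distrib]
      refine Finset.sum_congr rfl fun m _ => ?_
      rw [hG]
      ring
    rw [h6, hM.pd_sq_base hL hu hy (hφ _ hs) l]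
    simp only [h1, add_mul, Finset.sum_add_distrib] at h3 ⊢
    rw [h3]
    simp only [mul_assoc, ← Finset.mul_sum]
    ring
  have h7 := congrFun (inv_mulVec_mulVec hg G) i
  rw [sprayCoeff]
  simp only [key]
  have h8 : ∑ l, (fundamentalTensor L u y)⁻¹ i l * (4 * (fundamentalTensor L u y *ᵥ G) l) =
      4 * G i := by
    rw [← h7, Matrix.mulVec, dotProduct, Finset.mul_sum]
    exact Finset.sum_congr rfl fun l _ => by ring
  rw [h8, hG]
  ring

/-- The fundamental tensor is positive definite only if `φ - s φ₂ + (b² - s²) φ₂₂ > 0`. -/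
lemma pdeDen_pos (hn : 2 ≤ n) (hM : IsConformalPair a b c Ω)
    (hL : ∀ u ∈ Ω, ∀ y, L u y = localMetric a b φ u y) (hu : u ∈ Ω)
    (hφ : ∀ s : ℝ, s ^ 2 ≤ normSq (a u) (b u) → ContDiffAt ℝ ∞ φ (normSq (a u) (b u), s))
    (h0 : ∀ s : ℝ, s ^ 2 ≤ normSq (a u) (b u) → 0 < φ (normSq (a u) (b u), s))
    (hg : ∀ y, y ≠ 0 → (fundamentalTensor L u y).PosDef) {s : ℝ}
    (hs : s ^ 2 ≤ normSq (a u) (b u)) : 0 < pdeDen φ (normSq (a u) (b u), s) := by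
  have ha := hM.posDef u hu
  obtain ⟨e₁, e₂, h1, h2, h12, hb1, hb2⟩ := exists_orthonormal_pair hn ha (b u)
  obtain ⟨β, hβ⟩ : ∃ β, β = √(normSq (a u) (b u)) := ⟨_, rfl⟩
  have hβ2 : β ^ 2 = normSq (a u) (b u) := by rw [hβ, Real.sq_sqrt (normSq_nonneg ha _)]
  rw [← hβ] at hb1
  -- Chosen so that the unit vector `y = p e₁ + q e₂` realises the prescribed value `β(y)/α(y) = s`;
  -- `v` below completes `y` to an orthonormal basis of the plane.
  obtain ⟨p, q, hpq, hps⟩ : ∃ p q : ℝ, p ^ 2 + q ^ 2 = 1 ∧ p * β = s := by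
    rcases eq_or_ne β 0 with h | h
    · refine ⟨1, 0, by norm_num, ?_⟩
      rw [← hβ2, h] at hs
      rw [h]
      nlinarith [sq_nonneg s]
    · have : (s / β) ^ 2 ≤ 1 := by
        rw [div_pow, hβ2]
        exact div_le_one_of_le₀ hs (normSq_nonneg ha _)
      exact ⟨s / β, √(1 - (s / β) ^ 2), by rw [Real.sq_sqrt (by linarith)]; ring,
        div_mul_cancel₀ _ h⟩
  have h21 : e₂ ⬝ᵥ a u *ᵥ e₁ = 0 := by rw [dotProduct_mulVec_symm ha, h12]
  rw [quad] at h1 h2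
  obtain ⟨y, hyd⟩ : ∃ y : Coord n, y.ofLp = p • e₁ + q • e₂ := ⟨WithLp.toLp 2 _, rfl⟩
  obtain ⟨v, hv⟩ : ∃ v : Fin n → ℝ, v = q • e₁ - p • e₂ := ⟨_, rfl⟩
  have qy : quad (a u) y.ofLp = 1 := by
    rw [hyd, quad]
    simp only [Matrix.mulVec_add, Matrix.mulVec_smul, dotProduct_add, add_dotProduct,
      smul_dotProduct, dotProduct_smul, smul_eq_mul, h1, h2, h12, h21]
    linarith
  have qv : quad (a u) v = 1 := by
    rw [hv, quad]
    simp only [Matrix.mulVec_sub, Matrix.mulVec_smul, dotProduct_sub, sub_dotProduct,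
      smul_dotProduct, dotProduct_smul, smul_eq_mul, h1, h2, h12, h21]
    linarith
  have qyv : v ⬝ᵥ a u *ᵥ y.ofLp = 0 := by
    rw [hv, hyd]
    simp only [Matrix.mulVec_add, Matrix.mulVec_smul, dotProduct_add, sub_dotProduct,
      smul_dotProduct, dotProduct_smul, smul_eq_mul, h1, h2, h12, h21]
    ring
  have by' : b u ⬝ᵥ y.ofLp = s := by
    rw [hyd, dotProduct_add, dotProduct_smul, dotProduct_smul, hb1, hb2, ← hps]
    simp
  have bv : b u ⬝ᵥ v = q * β := by
    rw [hv, dotProduct_sub, dotProduct_smul, dotProduct_smul, hb1, hb2]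
    simp
  have hy : y ≠ 0 := by
    rintro rfl
    simp [quad] at qy
  have hα : alpha (a u) y = 1 := by rw [alpha, qy, Real.sqrt_one]
  have hr : ratio (a u) (b u) y = s := by rw [ratio, hα, by', div_one]
  have hf := h0 s hs
  -- At `y` the differential of `F` is `φ` on `y` and `φ₂ q β` on `v`, so `z` is tangent to the
  -- indicatrix. On `z` the fundamental tensor takes the value `φ³` times the denominator of `H`.
  obtain ⟨z, hz⟩ : ∃ z : Fin n → ℝ, z = φ (normSq (a u) (b u), s) • v
      - (d2 φ (normSq (a u) (b u), s) * (q * β)) • y.ofLp := ⟨_, rfl⟩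
  have hz0 : z ≠ 0 := by
    intro h
    have h3 : z ⬝ᵥ a u *ᵥ v = 0 := by rw [h, zero_dotProduct]
    rw [hz, sub_dotProduct, smul_dotProduct, smul_dotProduct,
      dotProduct_mulVec_symm ha y.ofLp v, qyv] at h3
    rw [quad] at qv
    rw [qv] at h3
    simp at h3
    exact hf.ne' h3
  have hpos := quad_pos (hg y hy) hz0
  have hbz : b u ⬝ᵥ z = φ (normSq (a u) (b u), s) * (q * β)
      - d2 φ (normSq (a u) (b u), s) * (q * β) * s := by
    rw [hz, dotProduct_sub, dotProduct_smul, dotProduct_smul, bv, by', smul_eq_mul, smul_eq_mul]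
  have hyz : z ⬝ᵥ a u *ᵥ y.ofLp = - (d2 φ (normSq (a u) (b u), s) * (q * β)) := by
    rw [quad] at qy
    rw [hz, sub_dotProduct, smul_dotProduct, smul_dotProduct, qyv, qy]
    simp
  have hzz : quad (a u) z = φ (normSq (a u) (b u), s) ^ 2
      + (d2 φ (normSq (a u) (b u), s) * (q * β)) ^ 2 := by
    rw [hz, sub_eq_add_neg, ← neg_smul, quad_add ha, quad_smul, quad_smul, qv, qy,
      Matrix.mulVec_smul, smul_dotProduct, dotProduct_smul, qyv]
    simp
  have e1 : ∀ l, (fundamentalTensor L u y *ᵥ z) l =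
      (∑ m, vert2 (a u) (b u) φ (normSq (a u) (b u)) m l y * z m) / 2 :=
    hM.fundamentalTensor_mulVec hL hu hφ hy z
  have e2 : quad (fundamentalTensor L u y) z =
      ((z ⬝ᵥ a u *ᵥ y.ofLp) * coefX φ (normSq (a u) (b u), s) * (b u ⬝ᵥ z)
      + d2 (coefX φ) (normSq (a u) (b u), s) * (b u ⬝ᵥ z - s * (z ⬝ᵥ a u *ᵥ y.ofLp)) * (b u ⬝ᵥ z)
      + d2 (coefY φ) (normSq (a u) (b u), s) * (b u ⬝ᵥ z - s * (z ⬝ᵥ a u *ᵥ y.ofLp)) *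
        (z ⬝ᵥ a u *ᵥ y.ofLp) + coefY φ (normSq (a u) (b u), s) * quad (a u) z) / 2 := by
    rw [quad, dotProduct]
    simp only [e1, sum_vert2_mul ha, ratioGrad, hα, hr]
    have e3 : b u ⬝ᵥ z = ∑ l, z l * b u l := Finset.sum_congr rfl fun l _ => mul_comm _ _
    have e4 : quad (a u) z = ∑ l, z l * (a u *ᵥ z) l := rfl
    have e5 : z ⬝ᵥ a u *ᵥ y.ofLp = ∑ l, z l * (a u *ᵥ y.ofLp) l := rfl
    generalize hB : b u ⬝ᵥ z = B at *
    generalize hC : z ⬝ᵥ a u *ᵥ y.ofLp = C at *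
    generalize coefX φ (normSq (a u) (b u), s) = X
    generalize d2 (coefX φ) (normSq (a u) (b u), s) = X2
    generalize coefY φ (normSq (a u) (b u), s) = Y
    generalize d2 (coefY φ) (normSq (a u) (b u), s) = Y2
    -- One factor in each term is singled out to be expanded as a sum over `l`; the others stay
    -- scalars.
    have e6 : (C * X * B + X2 * (B - s * C) * B + Y2 * (B - s * C) * C + Y * quad (a u) z) / 2 =
        (X * B / 2 - X2 * s * B / 2 - Y2 * s * C / 2) * C + (X2 * B / 2 + Y2 * C / 2) * B
          + Y / 2 * quad (a u) z := by ring
    rw [e6]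
    conv_rhs => rw [e4]; enter [1, 1, 2]; rw [e5]
    conv_rhs => enter [1, 2, 2]; rw [e3]
    simp only [Finset.mul_sum, ← Finset.sum_add_distrib]
    exact Finset.sum_congr rfl fun l _ => by ring
  have e7 : quad (fundamentalTensor L u y) z =
      φ (normSq (a u) (b u), s) ^ 3 * pdeDen φ (normSq (a u) (b u), s) := by
    have hq : (q * β) ^ 2 = normSq (a u) (b u) - s ^ 2 := by
      rw [← hβ2, ← hps]; linear_combination β ^ 2 * hpq
    have hden : pdeDen φ (normSq (a u) (b u), s) = φ (normSq (a u) (b u), s)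
      - s * d2 φ (normSq (a u) (b u), s) + (normSq (a u) (b u) - s ^ 2) *
      d2 (d2 φ) (normSq (a u) (b u), s) := rfl
    rw [e2, hden, hbz, hyz, hzz, d2_coefX (hφ s hs), d2_coefY (hφ s hs), coefX, coefY, ← hq]
    ring
  rw [e7] at hpos
  exact pos_of_mul_pos_right hpos (by positivity)

end IsConformalPair

/-! ### Quadratic polynomials on lines -/

/-- `f` is a polynomial of degree at most two. -/
def IsQuadraticPoly (f : ℝ → ℝ) : Prop :=
  ∃ k₀ k₁ k₂ : ℝ, ∀ τ, f τ = k₀ + k₁ * τ + k₂ * τ ^ 2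

lemma IsQuadraticPoly.add {f g : ℝ → ℝ} (hf : IsQuadraticPoly f) (hg : IsQuadraticPoly g) :
    IsQuadraticPoly fun τ => f τ + g τ := by
  obtain ⟨k₀, k₁, k₂, hk⟩ := hf
  obtain ⟨l₀, l₁, l₂, hl⟩ := hg
  exact ⟨k₀ + l₀, k₁ + l₁, k₂ + l₂, fun τ => by simp only [hk, hl]; ring⟩

lemma IsQuadraticPoly.const_mul {f : ℝ → ℝ} (r : ℝ) (hf : IsQuadraticPoly f) :
    IsQuadraticPoly fun τ => r * f τ := by
  obtain ⟨k₀, k₁, k₂, hk⟩ := hf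
  exact ⟨r * k₀, r * k₁, r * k₂, fun τ => by simp only [hk]; ring⟩

lemma IsQuadraticPoly.sum {ι : Type*} {s : Finset ι} {f : ι → ℝ → ℝ}
    (hf : ∀ i ∈ s, IsQuadraticPoly (f i)) : IsQuadraticPoly fun τ => ∑ i ∈ s, f i τ := by
  classical
  induction s using Finset.induction_on with
  | empty => exact ⟨0, 0, 0, fun τ => by simp⟩
  | insert i s hi ih =>
    simp only [Finset.sum_insert hi]
    exact (hf i (Finset.mem_insert_self i s)).add
      (ih fun j hj => hf j (Finset.mem_insert_of_mem hj))

lemma isQuadraticPoly_of_hasDerivAt {f f₁ f₂ : ℝ → ℝ} (h : ∀ τ, HasDerivAt f (f₁ τ) τ)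
    (h₁ : ∀ τ, HasDerivAt f₁ (f₂ τ) τ) (h₂ : ∀ τ, HasDerivAt f₂ 0 τ) : IsQuadraticPoly f := by
  have c₂ : ∀ τ, f₂ τ = f₂ 0 := fun τ =>
    is_const_of_deriv_eq_zero (fun x => (h₂ x).differentiableAt) (fun x => (h₂ x).deriv) _ _
  have d₁ : ∀ τ, HasDerivAt (fun x => f₁ x - f₂ 0 * x) 0 τ := fun τ =>
    ((h₁ τ).sub ((hasDerivAt_id τ).const_mul (f₂ 0))).congr_deriv (by rw [c₂]; ring)
  have c₁ : ∀ τ, f₁ τ = f₁ 0 + f₂ 0 * τ := fun τ => by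
    have := is_const_of_deriv_eq_zero (fun x => (d₁ x).differentiableAt)
      (fun x => (d₁ x).deriv) τ 0
    simp only [mul_zero, sub_zero] at this
    linarith
  have d₀ : ∀ τ, HasDerivAt (fun x => f x - (f₁ 0 * x + f₂ 0 / 2 * x ^ 2)) 0 τ := fun τ =>
    ((h τ).sub (((hasDerivAt_id τ).const_mul (f₁ 0)).add
      ((hasDerivAt_pow 2 τ).const_mul (f₂ 0 / 2)))).congr_deriv (by rw [c₁]; push_cast; ring)
  refine ⟨f 0, f₁ 0, f₂ 0 / 2, fun τ => ?_⟩
  have := is_const_of_deriv_eq_zero (fun x => (d₀ x).differentiableAt) (fun x => (d₀ x).deriv) τ 0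
  simp only [mul_zero, ne_eq, OfNat.ofNat_ne_zero, not_false_eq_true, zero_pow, add_zero,
    sub_zero] at this
  linarith

/-- A function on `ℝⁿ ∖ 0` with vanishing third derivatives is quadratic on lines. -/
lemma isQuadraticPoly_line {n : ℕ} {h : Coord n → ℝ} (hs : ∀ y, y ≠ 0 → ContDiffAt ℝ ∞ h y)
    (h3 : ∀ j k l y, y ≠ 0 → pd (fun y₁ => pd (fun y₂ => pd h l y₂) k y₁) j y = 0)
    {y v : Coord n} (hy : ∀ τ : ℝ, y + τ • v ≠ 0) :
    IsQuadraticPoly fun τ => h (y + τ • v) := by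
  refine isQuadraticPoly_of_hasDerivAt
    (f₁ := fun τ => ∑ l, pd h l (y + τ • v) * v l)
    (f₂ := fun τ => ∑ l, (∑ k, pd (pd h l) k (y + τ • v) * v k) * v l) (fun τ => ?_) (fun τ => ?_)
    fun τ => ?_
  · exact (hs _ (hy τ)).differentiableAt_infty.hasGrad.line
  · exact HasDerivAt.fun_sum fun l _ =>
      (contDiffAt_pd (hs _ (hy τ)) l).differentiableAt_infty.hasGrad.line.mul_const _
  · refine (HasDerivAt.fun_sum fun l _ => (HasDerivAt.fun_sum fun k _ =>
      (contDiffAt_pd (contDiffAt_pd (hs _ (hy τ)) l)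
        k).differentiableAt_infty.hasGrad.line.mul_const _).mul_const _).congr_deriv ?_
    refine Finset.sum_eq_zero fun l _ => ?_
    rw [Finset.sum_eq_zero fun k _ => ?_, zero_mul]
    rw [Finset.sum_eq_zero fun j _ => ?_, zero_mul]
    rw [show pd (pd (pd h l) k) j (y + τ • v) = 0 from h3 j k l _ (hy τ), zero_mul]

/-! ### Quadratic forms of matrices that need not be symmetric -/

section

variable {n : ℕ} (C : Matrix (Fin n) (Fin n) ℝ)

lemma contDiffAt_quad (y : Coord n) : ContDiffAt ℝ ∞ (fun z : Coord n => quad C z.ofLp) y := by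
  unfold quad dotProduct Matrix.mulVec dotProduct
  fun_prop

lemma hasGrad_quad_add_transpose (y : Coord n) :
    HasGrad (fun z => quad C z.ofLp) (fun i => ((C + Cᵀ) *ᵥ y.ofLp) i) y := by
  have h : HasGrad (fun z : Coord n => ∑ i, z i * (C i ⬝ᵥ z.ofLp)) _ y :=
    HasGrad.sum (s := Finset.univ) fun j _ => (hasGrad_coord j).mul (hasGrad_dotProduct (C j) y)
  refine h.congr_grad fun i => ?_
  rw [Finset.sum_add_distrib, Matrix.add_mulVec]
  simp [Matrix.mulVec, dotProduct, mul_comm]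

lemma pd_pd_pd_quad (j k l : Fin n) (y : Coord n) :
    pd (fun y₁ => pd (fun y₂ => pd (fun y₃ => quad C y₃.ofLp) l y₂) k y₁) j y = 0 := by
  have h1 : ∀ y₂, pd (fun y₃ : Coord n => quad C y₃.ofLp) l y₂ = (C + Cᵀ) l ⬝ᵥ y₂.ofLp :=
    fun y₂ => (hasGrad_quad_add_transpose C y₂).pd l
  simp only [h1, (hasGrad_dotProduct _ _).pd, (hasGrad_const _).pd]

lemma isQuadraticPoly_quad (y v : Fin n → ℝ) : IsQuadraticPoly fun τ => quad C (y + τ • v) := by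
  refine ⟨quad C y, y ⬝ᵥ C *ᵥ v + v ⬝ᵥ C *ᵥ y, quad C v, fun τ => ?_⟩
  simp only [quad, Matrix.mulVec_add, Matrix.mulVec_smul, dotProduct_add, add_dotProduct,
    smul_dotProduct, dotProduct_smul, smul_eq_mul]
  ring

variable {C}

lemma quad_matrix_add (D : Matrix (Fin n) (Fin n) ℝ) (v : Fin n → ℝ) :
    quad (C + D) v = quad C v + quad D v := by
  simp [quad, Matrix.add_mulVec]

lemma quad_matrix_smul (r : ℝ) (v : Fin n → ℝ) : quad (r • C) v = r * quad C v := by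
  simp [quad, Matrix.smul_mulVec]

lemma quad_vecMulVec (p q v : Fin n → ℝ) :
    quad (Matrix.vecMulVec p q) v = (p ⬝ᵥ v) * (q ⬝ᵥ v) := by
  rw [quad, Matrix.vecMulVec_mulVec, dotProduct_smul, dotProduct_comm v p]
  simp

end

/-! ### The ordinary differential equation for `H` -/

/-- A function of `s = pβ/√(p²+q²)` for which `q √(p²+q²) J` is quadratic on the lines `p = 1`
and `q = 1` is a multiple of `s`. -/
lemma exists_eq_mul_of_isQuadraticPoly {J : ℝ → ℝ} {β : ℝ} (hβ : 0 < β)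
    (h1 : IsQuadraticPoly fun q => q * (√(1 + q ^ 2) * J (β / √(1 + q ^ 2))))
    (h2 : IsQuadraticPoly fun p => √(p ^ 2 + 1) * J (p * β / √(p ^ 2 + 1))) :
    ∃ κ : ℝ, ∀ s, s ^ 2 < β ^ 2 → J s = κ * s := by
  obtain ⟨l₀, l₁, l₂, hl⟩ := h1
  obtain ⟨k₀, k₁, k₂, hk⟩ := h2
  have hl0 : l₀ = 0 := by have := hl 0; simpa using this.symm
  -- The cofactor of `q` is even in `q`, so the quadratic coefficient drops out on comparing `q`
  -- with `-q`.
  have hm : ∀ q, q ≠ 0 → √(1 + q ^ 2) * J (β / √(1 + q ^ 2)) = l₁ := fun q hq => by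
    have e1 := hl q
    have e2 := hl (-q)
    simp only [neg_sq] at e2
    have e3 : q * (√(1 + q ^ 2) * J (β / √(1 + q ^ 2))) = q * l₁ := by rw [hl0] at e1 e2; linarith
    exact mul_left_cancel₀ hq e3
  -- For `p > 0` the points `(p, 1)` and `(1, 1/p)` lie on one ray, and `√(p²+q²) J` is homogeneous
  -- of degree one. Three values of `p` then eliminate `k₀` and `k₂`.
  have hw : ∀ p, 0 < p → k₀ + k₁ * p + k₂ * p ^ 2 = l₁ * p := fun p hp => by
    rw [← hk, ← hm p⁻¹ (inv_ne_zero hp.ne')]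
    have e1 : √(1 + p⁻¹ ^ 2) = √(p ^ 2 + 1) / p := by
      rw [← Real.sqrt_sq hp.le, ← Real.sqrt_div (by positivity), Real.sqrt_sq hp.le]
      congr 1
      field_simp
    have h0 : 0 < √(p ^ 2 + 1) := by positivity
    have e2 : β / √(1 + p⁻¹ ^ 2) = p * β / √(p ^ 2 + 1) := by
      rw [e1]; field_simp
    rw [e2, e1]
    field_simp
  have w1 := hw 1 one_pos
  have w2 := hw 2 two_pos
  have w3 := hw 3 three_pos
  have hk2 : k₂ = 0 := by linarith
  have hk0 : k₀ = 0 := by linarith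
  -- The parameter `p = s/√(β² - s²)` is the one at which `pβ/√(p²+1)` equals `s`.
  refine ⟨k₁ / β, fun s hs => ?_⟩
  have hd : 0 < β ^ 2 - s ^ 2 := by linarith
  have hr : 0 < √(β ^ 2 - s ^ 2) := Real.sqrt_pos.2 hd
  have hr2 := Real.sq_sqrt hd.le
  have e1 : √((s / √(β ^ 2 - s ^ 2)) ^ 2 + 1) = β / √(β ^ 2 - s ^ 2) := by
    rw [div_pow, hr2, ← Real.sqrt_sq hβ.le, ← Real.sqrt_div (by positivity), Real.sqrt_sq hβ.le]
    congr 1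
    field_simp
    ring
  have e2 : s / √(β ^ 2 - s ^ 2) * β / (β / √(β ^ 2 - s ^ 2)) = s := by field_simp
  have e3 := hk (s / √(β ^ 2 - s ^ 2))
  simp only [e1, e2, hk0, hk2] at e3
  field_simp at e3 ⊢
  exact mul_left_cancel₀ hr.ne' (by linarith)

/-- The solutions of `2 s H + (β² - s²) H' = κ s`. -/
lemma exists_quadratic_of_ode {h h' : ℝ → ℝ} {β κ : ℝ} (hβ : 0 < β)
    (hd : ∀ s, s ^ 2 ≤ β ^ 2 → HasDerivAt h (h' s) s)
    (ho : ∀ s, s ^ 2 < β ^ 2 → 2 * s * h s + (β ^ 2 - s ^ 2) * h' s = κ * s) :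
    ∃ f g : ℝ, ∀ s, s ^ 2 ≤ β ^ 2 → h s = (f + g * s ^ 2) / 2 := by
  have hI : ∀ s, s ∈ Set.Ioo (-β) β → s ^ 2 < β ^ 2 := fun s hs => sq_lt_sq' hs.1 hs.2
  -- `κ/2` is a particular solution and `β² - s²` solves the homogeneous equation, so this quotient
  -- is constant. The endpoints follow by continuity.
  have hq : ∀ s ∈ Set.Ioo (-β) β,
      HasDerivAt (fun s => (h s - κ / 2) / (β ^ 2 - s ^ 2)) 0 s := fun s hs => by
    have h0 : β ^ 2 - s ^ 2 ≠ 0 := by linarith [hI s hs]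
    refine (((hd s (hI s hs).le).sub_const (κ / 2)).div
      ((hasDerivAt_pow 2 s).const_sub (β ^ 2)) h0).congr_deriv ?_
    rw [div_eq_zero_iff]
    left
    have := ho s (hI s hs)
    push_cast
    linear_combination this
  have hc : ∀ s ∈ Set.Ioo (-β) β, (h s - κ / 2) / (β ^ 2 - s ^ 2) =
      (h 0 - κ / 2) / (β ^ 2 - 0 ^ 2) := fun s hs =>
    isOpen_Ioo.is_const_of_deriv_eq_zero isPreconnected_Ioo
      (fun x hx => (hq x hx).differentiableAt.differentiableWithinAt)
      (fun x hx => (hq x hx).deriv) hs ⟨by linarith, hβ⟩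
  obtain ⟨μ, hμ⟩ : ∃ μ, μ = (h 0 - κ / 2) / (β ^ 2 - 0 ^ 2) := ⟨_, rfl⟩
  have he : Set.EqOn h (fun s => (κ + 2 * μ * β ^ 2 + -(2 * μ) * s ^ 2) / 2) (Set.Ioo (-β) β) :=
    fun s hs => by
      have h0 : β ^ 2 - s ^ 2 ≠ 0 := by linarith [hI s hs]
      have := hc s hs
      rw [← hμ, div_eq_iff h0] at this
      simp only
      linarith
  have hcl : Set.Icc (-β) β ⊆ closure (Set.Ioo (-β) β) := by
    rw [closure_Ioo (by linarith)]
  have he' := he.of_subset_closure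
    (fun s hs => (hd s (sq_le_sq' hs.1 hs.2)).continuousAt.continuousWithinAt)
    (by fun_prop) Set.Ioo_subset_Icc_self hcl
  exact ⟨_, _, fun s hs => he' (abs_le.1 (abs_le_of_sq_le_sq hs hβ.le))⟩

/-- At `b² = t`, the function `φ` is smooth and positive, and so is the denominator of `H`. -/
structure IsAdmissible (φ : ℝ × ℝ → ℝ) (t : ℝ) : Prop where
  smooth : ∀ s : ℝ, s ^ 2 ≤ t → ContDiffAt ℝ ∞ φ (t, s)
  pos : ∀ s : ℝ, s ^ 2 ≤ t → 0 < φ (t, s)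
  den_pos : ∀ s : ℝ, s ^ 2 ≤ t → 0 < pdeDen φ (t, s)

/-- The function `2 s H + (b² - s²) H₂`. -/
def auxJ (φ : ℝ × ℝ → ℝ) (p : ℝ × ℝ) : ℝ :=
  2 * p.2 * Hfun φ p + (p.1 - p.2 ^ 2) * d2 (Hfun φ) p

section

variable {φ : ℝ × ℝ → ℝ} {p : ℝ × ℝ} {t s : ℝ}

lemma contDiffAt_pdeNum (h : ContDiffAt ℝ ∞ φ p) : ContDiffAt ℝ ∞ (pdeNum φ) p :=
  (contDiffAt_d2 (contDiffAt_d2 h)).sub (contDiffAt_const.mul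
    ((contDiffAt_d1 h).sub (contDiffAt_snd.mul (contDiffAt_d2 (contDiffAt_d1 h)))))

lemma contDiffAt_pdeDen (h : ContDiffAt ℝ ∞ φ p) : ContDiffAt ℝ ∞ (pdeDen φ) p :=
  (h.sub (contDiffAt_snd.mul (contDiffAt_d2 h))).add
    ((contDiffAt_fst.sub (contDiffAt_snd.pow 2)).mul (contDiffAt_d2 (contDiffAt_d2 h)))

lemma IsAdmissible.contDiffAt_Hfun (h : IsAdmissible φ t) (hs : s ^ 2 ≤ t) :
    ContDiffAt ℝ ∞ (Hfun φ) (t, s) :=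
  (contDiffAt_pdeNum (h.smooth s hs)).div
    (contDiffAt_const.mul (contDiffAt_pdeDen (h.smooth s hs)))
    (mul_ne_zero two_ne_zero (h.den_pos s hs).ne')

lemma IsAdmissible.contDiffAt_projFactor (h : IsAdmissible φ t) (hs : s ^ 2 ≤ t) :
    ContDiffAt ℝ ∞ (projFactor φ) (t, s) := by
  have h1 := h.smooth s hs
  exact ((((contDiffAt_d2 h1).div_const 2).add (contDiffAt_snd.mul (contDiffAt_d1 h1))).sub
    ((h.contDiffAt_Hfun hs).mul ((contDiffAt_snd.mul h1).add
      ((contDiffAt_fst.sub (contDiffAt_snd.pow 2)).mul (contDiffAt_d2 h1))))).div h1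
      (h.pos s hs).ne'

lemma IsAdmissible.contDiffAt_auxJ (h : IsAdmissible φ t) (hs : s ^ 2 ≤ t) :
    ContDiffAt ℝ ∞ (auxJ φ) (t, s) := by
  have h1 := h.contDiffAt_Hfun hs
  exact ((contDiffAt_const.mul contDiffAt_snd).mul h1).add
    ((contDiffAt_fst.sub (contDiffAt_snd.pow 2)).mul (contDiffAt_d2 h1))

end

/-! ### The function inside the Douglas tensor -/

/-- The function `Gⁱ - (n+1)⁻¹ (∂Gᵐ/∂yᵐ) yⁱ` whose third derivatives form the Douglas tensor. -/
def projSpray {n : ℕ} (L : Coord n → Coord n → ℝ) (i : Fin n) (u y : Coord n) : ℝ :=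
  sprayCoeff L i u y - 1 / ((n : ℝ) + 1) * (∑ m, pd (fun z => sprayCoeff L m u z) m y) * y i

section

variable {n : ℕ} {a : Matrix (Fin n) (Fin n) ℝ} {b : Fin n → ℝ} {φ : ℝ × ℝ → ℝ} {y : Coord n}

/-- Euler's relation for `s`, which is homogeneous of degree zero. -/
lemma sum_ratioGrad_mul (ha : a.PosDef) (hy : y ≠ 0) :
    ∑ m, ratioGrad a b m y * y m = 0 := by
  have h0 := alpha_pos ha hy
  have e : ∀ m, ratioGrad a b m y * y m = (alpha a y)⁻¹ * (b m * y m) -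
      ratio a b y / alpha a y ^ 2 * (y m * (a *ᵥ y.ofLp) m) := fun m => by
    rw [ratioGrad]; field_simp
  simp only [e, Finset.sum_sub_distrib, ← Finset.mul_sum]
  have h1 : ∑ m, b m * y m = ratio a b y * alpha a y := (ratio_mul_alpha ha hy).symm
  have h2 : ∑ m, y m * (a *ᵥ y.ofLp) m = alpha a y ^ 2 := (alpha_sq ha y).symm
  rw [h1, h2]
  field_simp
  ring

lemma sum_ratioGrad_mul_dual (ha : a.PosDef) (hy : y ≠ 0) :
    ∑ m, ratioGrad a b m y * (a⁻¹ *ᵥ b) m = (normSq a b - ratio a b y ^ 2) / alpha a y := by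
  have h0 := alpha_pos ha hy
  have e : ∀ m, ratioGrad a b m y * (a⁻¹ *ᵥ b) m = (alpha a y)⁻¹ * (b m * (a⁻¹ *ᵥ b) m) -
      ratio a b y / alpha a y ^ 2 * ((a⁻¹ *ᵥ b) m * (a *ᵥ y.ofLp) m) := fun m => by
    rw [ratioGrad]; field_simp
  simp only [e, Finset.sum_sub_distrib, ← Finset.mul_sum]
  have h1 : ∑ m, b m * (a⁻¹ *ᵥ b) m = normSq a b := rfl
  have h2 : ∑ m, (a⁻¹ *ᵥ b) m * (a *ᵥ y.ofLp) m = ratio a b y * alpha a y := by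
    rw [ratio_mul_alpha ha hy]
    change (a⁻¹ *ᵥ b) ⬝ᵥ a *ᵥ y.ofLp = _
    rw [dotProduct_mulVec_symm ha, mulVec_inv_mulVec ha, dotProduct_comm]
  rw [h1, h2]
  field_simp

lemma sum_alphaGrad_mul (v : Fin n → ℝ) :
    ∑ m, (a *ᵥ y.ofLp) m / alpha a y * v m = (v ⬝ᵥ a *ᵥ y.ofLp) / alpha a y := by
  rw [dotProduct, Finset.sum_div]
  exact Finset.sum_congr rfl fun m _ => by ring

variable (a b φ) in
/-- The function `α² H`. -/
def auxW (y : Coord n) : ℝ := alpha a y ^ 2 * Hfun φ (normSq a b, ratio a b y)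

/-- The gradient of `α² H`. -/
lemma hasGrad_auxW (ha : a.PosDef) (hφ : IsAdmissible φ (normSq a b)) (hy : y ≠ 0) :
    HasGrad (auxW a b φ) (fun m => 2 * alpha a y * Hfun φ (normSq a b, ratio a b y) *
      ((a *ᵥ y.ofLp) m / alpha a y) + alpha a y ^ 2 * d2 (Hfun φ) (normSq a b, ratio a b y) *
      ratioGrad a b m y) y := by
  have hα := hasGrad_alpha ha hy
  have hH := hasGrad_comp_ratio ha hy
    (hφ.contDiffAt_Hfun (ratio_sq_le ha hy)).differentiableAt_infty
  refine ((hα.mul hα).mul hH).congr (Filter.Eventually.of_forall fun z => ?_) |>.congr_grad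
    fun m => ?_
  · rw [auxW, sq]
  · rw [ratioGrad]; ring

/-- The origin of `auxJ`: differentiation along `bᵐ` takes `α²` to `2 α s` and `s` to `(b² - s²)/α`.
-/
lemma sum_pd_auxW (ha : a.PosDef) (hφ : IsAdmissible φ (normSq a b)) (hy : y ≠ 0) :
    ∑ m, pd (auxW a b φ) m y * (a⁻¹ *ᵥ b) m =
      alpha a y * auxJ φ (normSq a b, ratio a b y) := by
  have h0 := alpha_pos ha hy
  simp only [(hasGrad_auxW ha hφ hy).pd, add_mul, Finset.sum_add_distrib]
  simp only [mul_assoc _ _ ((a⁻¹ *ᵥ b) _), ← Finset.mul_sum]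
  rw [sum_alphaGrad_mul, sum_ratioGrad_mul_dual ha hy, dotProduct_mulVec_symm ha,
    mulVec_inv_mulVec ha, dotProduct_comm, ← ratio_mul_alpha ha hy, auxJ]
  field_simp

variable (a b φ) in
/-- The function `α E`. -/
def auxP (y : Coord n) : ℝ := alpha a y * projFactor φ (normSq a b, ratio a b y)

/-- Euler's relation in degree one; it makes the projective term cancel in the Douglas tensor. -/
lemma exists_hasGrad_auxP (ha : a.PosDef) (hφ : IsAdmissible φ (normSq a b)) (hy : y ≠ 0) :
    ∃ w, HasGrad (auxP a b φ) w y ∧ ∑ m, w m * y m = auxP a b φ y := by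
  have h0 := alpha_pos ha hy
  refine ⟨_, (hasGrad_alpha ha hy).mul (hasGrad_comp_ratio ha hy
    (hφ.contDiffAt_projFactor (ratio_sq_le ha hy)).differentiableAt_infty), ?_⟩
  have e : ∀ m, ((a *ᵥ y.ofLp) m / alpha a y * projFactor φ (normSq a b, ratio a b y) +
      alpha a y * (d2 (projFactor φ) (normSq a b, ratio a b y) *
        ((b m - ratio a b y * (a *ᵥ y.ofLp) m / alpha a y) / alpha a y))) * y m =
      projFactor φ (normSq a b, ratio a b y) * ((a *ᵥ y.ofLp) m / alpha a y * y m) +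
      alpha a y * d2 (projFactor φ) (normSq a b, ratio a b y) * (ratioGrad a b m y * y m) :=
    fun m => by rw [ratioGrad]; ring
  simp only [e, Finset.sum_add_distrib, ← Finset.mul_sum]
  have h2 : y.ofLp ⬝ᵥ a *ᵥ y.ofLp = alpha a y ^ 2 := (alpha_sq ha y).symm
  rw [sum_alphaGrad_mul, sum_ratioGrad_mul ha hy, h2, auxP]
  field_simp
  ring

end

namespace IsConformalPair

variable {n : ℕ} {a : Coord n → Matrix (Fin n) (Fin n) ℝ} {b : Coord n → Fin n → ℝ}
  {c : Coord n → ℝ} {Ω : Set (Coord n)} {u y : Coord n} {φ : ℝ × ℝ → ℝ}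
  {L : Coord n → Coord n → ℝ}

/-- Up to a quadratic polynomial and a term that cancels, `G - (n+1)⁻¹ (div G) y` is
`c (α² H bⁱ - (n+1)⁻¹ bᵐ (α² H)_m yⁱ)`. -/
lemma exists_projSpray_eq (hM : IsConformalPair a b c Ω)
    (hL : ∀ u ∈ Ω, ∀ y, L u y = localMetric a b φ u y) (hu : u ∈ Ω)
    (hφ : IsAdmissible φ (normSq (a u) (b u)))
    (hg : ∀ y, y ≠ 0 → (fundamentalTensor L u y).PosDef) :
    ∃ C : Fin n → Matrix (Fin n) (Fin n) ℝ, ∀ i y, y ≠ 0 → projSpray L i u y =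
      quad (C i) y.ofLp + c u * (auxW (a u) (b u) φ y * ((a u)⁻¹ *ᵥ b u) i -
        1 / ((n : ℝ) + 1) * (∑ m, pd (auxW (a u) (b u) φ) m y * ((a u)⁻¹ *ᵥ b u) m) * y i) := by
  have ha := hM.posDef u hu
  obtain ⟨x, hx⟩ : ∃ x, x = (a u)⁻¹ *ᵥ b u := ⟨_, rfl⟩
  obtain ⟨Γ, hΓ⟩ : ∃ Γ : Fin n → Matrix (Fin n) (Fin n) ℝ,
      Γ = fun i => Matrix.of fun k j => christoffel a i k j u / 2 := ⟨_, rfl⟩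
  have hΓq : ∀ i (z : Coord n), (∑ k, conn a u i k z.ofLp * z k) / 2 = quad (Γ i) z.ofLp :=
    fun i z => by
      rw [quad, dotProduct, Finset.sum_div]
      refine Finset.sum_congr rfl fun k _ => ?_
      rw [conn, Matrix.mulVec, dotProduct, Finset.sum_mul, Finset.sum_div, Finset.mul_sum]
      refine Finset.sum_congr rfl fun j _ => ?_
      simp only [hΓ, Matrix.of_apply]
      ring
  have hspray : ∀ i (z : Coord n), z ≠ 0 → sprayCoeff L i u z =
      quad (Γ i) z.ofLp + c u * (auxP (a u) (b u) φ z * z i + auxW (a u) (b u) φ z * x i) :=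
    fun i z hz => by
      rw [hM.sprayCoeff_eq hL hu hφ.smooth (fun s hs => (hφ.pos s hs).ne')
        (fun s hs => (hφ.den_pos s hs).ne') (hg z hz) hz, hΓq, auxP, auxW, hx]
  -- The divergence of the Christoffel part is the linear form `r`, so its product with `yⁱ` is
  -- again quadratic.
  obtain ⟨r, hr⟩ : ∃ r : Fin n → ℝ, r = fun k => ∑ m, (Γ m + (Γ m)ᵀ) m k := ⟨_, rfl⟩
  refine ⟨fun i => Γ i + (-(1 / ((n : ℝ) + 1))) • Matrix.vecMulVec r (Pi.single i 1),
    fun i y hy => ?_⟩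
  obtain ⟨w, hw, hwy⟩ := exists_hasGrad_auxP ha hφ hy
  have hdiv : ∀ m, pd (fun z => sprayCoeff L m u z) m y = ((Γ m + (Γ m)ᵀ) *ᵥ y.ofLp) m +
      c u * ((w m * y m + auxP (a u) (b u) φ y) + pd (auxW (a u) (b u) φ) m y * x m) :=
    fun m => by
      rw [pd_congr ((isOpen_ne.eventually_mem hy).mono fun z hz => hspray m z hz)]
      have h1 := (hasGrad_quad_add_transpose (Γ m) y).add
        (((hw.mul (hasGrad_coord m)).add ((hasGrad_auxW ha hφ hy).mul
          (hasGrad_const (x m)))).const_mul (c u))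
      rw [h1.pd, (hasGrad_auxW ha hφ hy).pd]
      simp
  -- The factor `n + 1` is `n` from the divergence of `y` and `1` from Euler's relation.
  have hsum : ∑ m, pd (fun z => sprayCoeff L m u z) m y = r ⬝ᵥ y.ofLp +
      c u * (((n : ℝ) + 1) * auxP (a u) (b u) φ y +
        ∑ m, pd (auxW (a u) (b u) φ) m y * x m) := by
    simp only [hdiv, Finset.sum_add_distrib, ← Finset.mul_sum, hwy]
    have h1 : ∑ m, ((Γ m + (Γ m)ᵀ) *ᵥ y.ofLp) m = r ⬝ᵥ y.ofLp := by
      simp only [Matrix.mulVec, dotProduct, hr, Finset.sum_mul]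
      rw [Finset.sum_comm]
    rw [h1, Finset.sum_const, Finset.card_univ, Fintype.card_fin, nsmul_eq_mul]
    ring
  rw [projSpray, hsum, hspray i y hy, quad_matrix_add, quad_matrix_smul, quad_vecMulVec,
    single_dotProduct, ← hx]
  have hn1 : (n : ℝ) + 1 ≠ 0 := by positivity
  field_simp
  ring

/-- If `H` is a quadratic polynomial in `s` without linear term, then the Douglas tensor
vanishes. -/
lemma douglasCoeff_eq_zero (hM : IsConformalPair a b c Ω)
    (hL : ∀ u ∈ Ω, ∀ y, L u y = localMetric a b φ u y) (hu : u ∈ Ω)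
    (hφ : IsAdmissible φ (normSq (a u) (b u)))
    (hg : ∀ y, y ≠ 0 → (fundamentalTensor L u y).PosDef)
    (hH : ∃ f g : ℝ, ∀ s, s ^ 2 ≤ normSq (a u) (b u) →
      Hfun φ (normSq (a u) (b u), s) = (f + g * s ^ 2) / 2)
    (hy : y ≠ 0) (i j k l : Fin n) : douglasCoeff L i j k l u y = 0 := by
  have ha := hM.posDef u hu
  obtain ⟨f, g, hfg⟩ := hH
  obtain ⟨C, hC⟩ := hM.exists_projSpray_eq hL hu hφ hg
  -- With `H = (f + g s²)/2` one has `α² H = (f α² + g β²)/2`.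
  obtain ⟨D, hD⟩ : ∃ D : Matrix (Fin n) (Fin n) ℝ,
      D = (f / 2) • a u + (g / 2) • Matrix.vecMulVec (b u) (b u) := ⟨_, rfl⟩
  have hW : ∀ z : Coord n, z ≠ 0 → auxW (a u) (b u) φ z = quad D z.ofLp := fun z hz => by
    rw [auxW, hfg _ (ratio_sq_le ha hz), hD, quad_matrix_add, quad_matrix_smul, quad_matrix_smul,
      quad_vecMulVec, ← ratio_mul_alpha ha hz, ← alpha_sq ha]
    ring
  obtain ⟨x, hx⟩ : ∃ x, x = (a u)⁻¹ *ᵥ b u := ⟨_, rfl⟩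
  have hV : ∀ z : Coord n, z ≠ 0 → ∑ m, pd (auxW (a u) (b u) φ) m z * x m =
      ((D + Dᵀ)ᵀ *ᵥ x) ⬝ᵥ z.ofLp := fun z hz => by
    rw [Matrix.mulVec_transpose, ← Matrix.dotProduct_mulVec]
    refine Finset.sum_congr rfl fun m _ => ?_
    rw [pd_congr ((isOpen_ne.eventually_mem hz).mono fun z' hz' => hW z' hz'),
      (hasGrad_quad_add_transpose D z).pd, mul_comm]
  obtain ⟨E, hE⟩ : ∃ E : Matrix (Fin n) (Fin n) ℝ, E = C i + c u • (x i • D +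
      (-(1 / ((n : ℝ) + 1))) • Matrix.vecMulVec ((D + Dᵀ)ᵀ *ᵥ x) (Pi.single i 1)) := ⟨_, rfl⟩
  have hS : ∀ z : Coord n, z ≠ 0 → projSpray L i u z = quad E z.ofLp := fun z hz => by
    rw [hC i z hz, ← hx, hW z hz, hV z hz, hE]
    simp only [quad_matrix_add, quad_matrix_smul, quad_vecMulVec, single_dotProduct]
    ring
  have h1 : ∀ z : Coord n, z ≠ 0 → pd (fun y₃ => projSpray L i u y₃) l z =
      pd (fun y₃ : Coord n => quad E y₃.ofLp) l z := fun z hz =>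
    pd_congr ((isOpen_ne.eventually_mem hz).mono fun z' hz' => hS z' hz') l
  have h2 : ∀ z : Coord n, z ≠ 0 → pd (fun y₂ => pd (fun y₃ => projSpray L i u y₃) l y₂) k z =
      pd (fun y₂ => pd (fun y₃ : Coord n => quad E y₃.ofLp) l y₂) k z := fun z hz =>
    pd_congr ((isOpen_ne.eventually_mem hz).mono fun z' hz' => h1 z' hz') k
  have h3 := pd_congr ((isOpen_ne.eventually_mem hy).mono fun z' hz' => h2 z' hz') j
  exact h3.trans (pd_pd_pd_quad E j k l y)

/-- If the Douglas tensor vanishes, then `H` is a quadratic polynomial in `s` without linear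
term. -/
lemma exists_Hfun_eq (hn : 2 ≤ n) (hM : IsConformalPair a b c Ω)
    (hL : ∀ u ∈ Ω, ∀ y, L u y = localMetric a b φ u y) (hu : u ∈ Ω) (hc : c u ≠ 0)
    (hφ : IsAdmissible φ (normSq (a u) (b u)))
    (hg : ∀ y, y ≠ 0 → (fundamentalTensor L u y).PosDef)
    (hD : ∀ i j k l y, y ≠ 0 → douglasCoeff L i j k l u y = 0) :
    ∃ f g : ℝ, ∀ s, s ^ 2 ≤ normSq (a u) (b u) →
      Hfun φ (normSq (a u) (b u), s) = (f + g * s ^ 2) / 2 := by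
  have ha := hM.posDef u hu
  rcases (normSq_nonneg ha (b u)).eq_or_lt with ht | ht
  -- Where `b = 0` the slice is the single point `s = 0`, and any value of `H` has the required
  -- form.
  · refine ⟨2 * Hfun φ (normSq (a u) (b u), 0), 0, fun s hs => ?_⟩
    rw [← ht] at hs
    have : s = 0 := by nlinarith [sq_nonneg s]
    rw [this]
    ring
  obtain ⟨C, hC⟩ := hM.exists_projSpray_eq hL hu hφ hg
  obtain ⟨x, hx⟩ : ∃ x, x = (a u)⁻¹ *ᵥ b u := ⟨_, rfl⟩
  obtain ⟨e₁, e₂, h1, h2, h12, hb1, hb2⟩ := exists_orthonormal_pair hn ha (b u)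
  obtain ⟨β, hβ⟩ : ∃ β, β = √(normSq (a u) (b u)) := ⟨_, rfl⟩
  have hβ0 : 0 < β := by rw [hβ]; exact Real.sqrt_pos.2 ht
  have hβ2 : β ^ 2 = normSq (a u) (b u) := by rw [hβ, Real.sq_sqrt ht.le]
  rw [← hβ] at hb1
  -- The covector dual to `e₂` annihilates `bⁱ`, so contracting with it removes the term `α² H bⁱ`
  -- and isolates `T`.
  obtain ⟨ξ, hξ⟩ : ∃ ξ, ξ = a u *ᵥ e₂ := ⟨_, rfl⟩
  have hξx : ∑ i, ξ i * x i = 0 := by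
    change ξ ⬝ᵥ x = 0
    rw [dotProduct_comm, hξ, dotProduct_mulVec_symm ha, hx, mulVec_inv_mulVec ha,
      dotProduct_comm, hb2]
  obtain ⟨T, hT⟩ : ∃ T : Coord n → ℝ, T = fun y =>
      alpha (a u) y * auxJ φ (normSq (a u) (b u), ratio (a u) (b u) y) := ⟨_, rfl⟩
  have hC' : ∀ i y, y ≠ 0 → projSpray L i u y = quad (C i) y.ofLp +
      c u * (auxW (a u) (b u) φ y * x i - 1 / ((n : ℝ) + 1) * T y * y i) := fun i y hy => by
    rw [hC i y hy, sum_pd_auxW ha hφ hy, hx, hT]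
  have hsmooth : ∀ i y, y ≠ 0 → ContDiffAt ℝ ∞ (projSpray L i u) y := fun i y hy => by
    have hr := ratio_sq_le (b := b u) ha hy
    have hα := contDiffAt_alpha ha hy
    have hW : ContDiffAt ℝ ∞ (auxW (a u) (b u) φ) y :=
      (hα.pow 2).mul (contDiffAt_comp_ratio ha hy (hφ.contDiffAt_Hfun hr))
    have hTs : ContDiffAt ℝ ∞ T y := by
      rw [hT]
      exact hα.mul (contDiffAt_comp_ratio ha hy (hφ.contDiffAt_auxJ hr))
    have hyi : ContDiffAt ℝ ∞ (fun z : Coord n => z i) y := by fun_prop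
    exact ((contDiffAt_quad (C i) y).add (contDiffAt_const.mul ((hW.mul contDiffAt_const).sub
      ((contDiffAt_const.mul hTs).mul hyi)))).congr_of_eventuallyEq
      ((isOpen_ne.eventually_mem hy).mono fun z hz => hC' i z hz)
  have hline : ∀ y v : Coord n, (∀ τ : ℝ, y + τ • v ≠ 0) →
      IsQuadraticPoly fun τ => (ξ ⬝ᵥ (y + τ • v).ofLp) * T (y + τ • v) := fun y v hyv => by
    have hn1 : (n : ℝ) + 1 ≠ 0 := by positivity
    have hp : IsQuadraticPoly fun τ => ((n : ℝ) + 1) / c u * ∑ i, ξ i *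
        (quad (C i) (y.ofLp + τ • v.ofLp) + (-1) * projSpray L i u (y + τ • v)) :=
      (IsQuadraticPoly.sum fun i _ => ((isQuadraticPoly_quad (C i) _ _).add
        ((isQuadraticPoly_line (hsmooth i) (fun j k l y hy => hD i j k l y hy)
          hyv).const_mul (-1))).const_mul (ξ i)).const_mul _
    obtain ⟨k₀, k₁, k₂, hk⟩ := hp
    refine ⟨k₀, k₁, k₂, fun τ => ?_⟩
    rw [← hk]
    have e1 : ∀ i, ξ i * (quad (C i) (y.ofLp + τ • v.ofLp) + (-1) * projSpray L i u (y + τ • v)) =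
        c u / ((n : ℝ) + 1) * T (y + τ • v) * (ξ i * (y + τ • v).ofLp i) -
        c u * auxW (a u) (b u) φ (y + τ • v) * (ξ i * x i) := fun i => by
      rw [hC' i _ (hyv τ), WithLp.ofLp_add, WithLp.ofLp_smul]
      ring
    simp only [e1, Finset.sum_sub_distrib, ← Finset.mul_sum, hξx]
    change _ = ((n : ℝ) + 1) / c u *
      (c u / ((n : ℝ) + 1) * T (y + τ • v) * (ξ ⬝ᵥ (y + τ • v).ofLp) - _)
    field_simp
    ring
  obtain ⟨E₁, hE₁⟩ : ∃ E : Coord n, E.ofLp = e₁ := ⟨WithLp.toLp 2 e₁, rfl⟩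
  obtain ⟨E₂, hE₂⟩ : ∃ E : Coord n, E.ofLp = e₂ := ⟨WithLp.toLp 2 e₂, rfl⟩
  have hquad : ∀ p q : ℝ, quad (a u) (p • E₁ + q • E₂).ofLp = p ^ 2 + q ^ 2 := fun p q => by
    rw [WithLp.ofLp_add, WithLp.ofLp_smul, WithLp.ofLp_smul, hE₁, hE₂, quad_add ha, quad_smul,
      quad_smul, Matrix.mulVec_smul, smul_dotProduct, dotProduct_smul, h12, h1, h2]
    simp
  have hne : ∀ p q : ℝ, 0 < p ^ 2 + q ^ 2 → p • E₁ + q • E₂ ≠ 0 := fun p q hpq h => by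
    have := hquad p q
    rw [h] at this
    simp [quad] at this
    linarith
  have hTpq : ∀ p q : ℝ, T (p • E₁ + q • E₂) =
      √(p ^ 2 + q ^ 2) * auxJ φ (normSq (a u) (b u), p * β / √(p ^ 2 + q ^ 2)) := fun p q => by
    have hb : b u ⬝ᵥ (p • E₁ + q • E₂).ofLp = p * β := by
      rw [WithLp.ofLp_add, WithLp.ofLp_smul, WithLp.ofLp_smul, hE₁, hE₂, dotProduct_add,
        dotProduct_smul, dotProduct_smul, hb1, hb2]
      simp
    rw [hT]
    simp only [ratio, alpha, hquad, hb]
  have hξpq : ∀ p q : ℝ, ξ ⬝ᵥ (p • E₁ + q • E₂).ofLp = q := fun p q => by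
    have h3 : ξ ⬝ᵥ e₁ = 0 := by rw [dotProduct_comm, hξ, h12]
    have h4 : ξ ⬝ᵥ e₂ = 1 := by rw [dotProduct_comm, hξ]; exact h2
    rw [WithLp.ofLp_add, WithLp.ofLp_smul, WithLp.ofLp_smul, hE₁, hE₂, dotProduct_add,
        dotProduct_smul, dotProduct_smul, h3, h4]
    simp
  obtain ⟨κ, hκ⟩ := exists_eq_mul_of_isQuadraticPoly
    (J := fun s => auxJ φ (normSq (a u) (b u), s)) hβ0
    (by
      have := hline E₁ E₂ fun τ => by simpa using hne 1 τ (by positivity)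
      obtain ⟨k₀, k₁, k₂, hk⟩ := this
      refine ⟨k₀, k₁, k₂, fun q => ?_⟩
      have e := hTpq 1 q
      have e' := hξpq 1 q
      simp only [one_smul, one_mul, one_pow] at e e'
      simp only [← hk, e, e'])
    (by
      have := hline E₂ E₁ fun τ => by simpa [add_comm] using hne τ 1 (by positivity)
      obtain ⟨k₀, k₁, k₂, hk⟩ := this
      refine ⟨k₀, k₁, k₂, fun p => ?_⟩
      have e := hTpq p 1
      have e' := hξpq p 1
      simp only [one_smul, one_pow] at e e'
      simp only [← hk, add_comm E₂, e, e', one_mul])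
  rw [← hβ2] at hκ hφ ⊢
  exact exists_quadratic_of_ode hβ0
    (fun s hs => hasDerivAt_d2 (hφ.contDiffAt_Hfun hs).differentiableAt_infty)
    (fun s hs => hκ s hs)

end IsConformalPair

/-! ### Metrics and forms on a manifold in a chart -/

section

variable {n : ℕ} {M : Type*} [TopologicalSpace M] [ChartedSpace (Coord n) M]
  {e : OpenPartialHomeomorph M (Coord n)} {u : Coord n}

lemma chart_mdifferentiable (he : e ∈ IsManifold.maximalAtlas (𝓡 n) ∞ M) :
    e.MDifferentiable (𝓡 n) (𝓡 n) :=
  ⟨(contMDiffOn_of_mem_maximalAtlas he).mdifferentiableOn (by simp),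
    (contMDiffOn_symm_of_mem_maximalAtlas he).mdifferentiableOn (by simp)⟩

lemma coordVec_eq_sum (v : Coord n) :
    coordVec e u v = ∑ i, v i • coordVec e u (EuclideanSpace.single i 1) := by
  have hv : v = ∑ i, v i • EuclideanSpace.single i (1 : ℝ) := by
    ext j
    simp [Pi.single_apply]
  let T : Coord n →L[ℝ] TangentSpace (𝓡 n) (e.symm u) := mfderiv (𝓡 n) (𝓡 n) e.symm u
  change T v = ∑ i, v i • T (EuclideanSpace.single i 1)
  conv_lhs => rw [hv, map_sum]
  exact Finset.sum_congr rfl fun i _ => map_smul T _ _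

variable [IsManifold (𝓡 n) ∞ M]

lemma coordVec_bijective (he : e ∈ IsManifold.maximalAtlas (𝓡 n) ∞ M) (hu : u ∈ e.target) :
    Function.Bijective (fun v : Coord n => coordVec e u v) :=
  have : IsManifold (𝓡 n) 1 M := IsManifold.of_le (n := ∞) (by simp)
  (chart_mdifferentiable he).symm.mfderiv_bijective hu

lemma inner_coordVec (a : RMetric n M) (v w : Coord n) :
    a.inner (e.symm u) (coordVec e u v) (coordVec e u w) = v.ofLp ⬝ᵥ a.comp e u *ᵥ w.ofLp := by
  rw [coordVec_eq_sum v, coordVec_eq_sum w]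
  simp only [map_sum, map_smul, sum_apply, smul_apply, smul_eq_mul, dotProduct, Matrix.mulVec,
    RMetric.comp, Matrix.of_apply, Finset.mul_sum]
  rw [Finset.sum_comm]
  exact Finset.sum_congr rfl fun i _ => Finset.sum_congr rfl fun j _ => by ring

lemma norm_coordVec (a : RMetric n M) (v : Coord n) :
    a.norm (e.symm u) (coordVec e u v) = alpha (a.comp e u) v := by
  rw [RMetric.norm, inner_coordVec, alpha, quad]

lemma val_coordVec (β : OneForm n M) (v : Coord n) :
    β.val (e.symm u) (coordVec e u v) = β.comp e u ⬝ᵥ v.ofLp := by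
  have h : β.val (e.symm u) (coordVec e u v) =
      ∑ i, v i * β.val (e.symm u) (coordVec e u (EuclideanSpace.single i 1)) := by
    conv_lhs => rw [coordVec_eq_sum v, OneForm.val, map_sum]
    exact Finset.sum_congr rfl fun i _ => map_smul (β (e.symm u)) _ _
  rw [h]
  exact Finset.sum_congr rfl fun i _ => mul_comm _ _

lemma comp_posDef (he : e ∈ IsManifold.maximalAtlas (𝓡 n) ∞ M) (hu : u ∈ e.target)
    (a : RMetric n M) : (a.comp e u).PosDef := by
  refine Matrix.PosDef.of_dotProduct_mulVec_pos ?_ fun v hv => ?_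
  · ext i j
    simp only [RMetric.comp, Matrix.conjTranspose_apply, Matrix.of_apply, star_trivial]
    exact a.symm _ _ _
  · have h := inner_coordVec (e := e) (u := u) a (WithLp.toLp 2 v) (WithLp.toLp 2 v)
    rw [star_trivial]
    change 0 < (WithLp.toLp 2 v).ofLp ⬝ᵥ a.comp e u *ᵥ (WithLp.toLp 2 v).ofLp
    rw [← h]
    refine a.pos _ _ fun h0 => hv ?_
    have h1 : coordVec e u (WithLp.toLp 2 v) = coordVec e u 0 :=
      h0.trans (map_zero (mfderiv (𝓡 n) (𝓡 n) e.symm u)).symm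
    have h2 := (coordVec_bijective he hu).1 h1
    exact congrArg WithLp.ofLp h2

/-- Cauchy–Schwarz bounds the supremum, and the normalised dual vector `a⁻¹b/|b|` attains it. -/
lemma formNorm_eq (he : e ∈ IsManifold.maximalAtlas (𝓡 n) ∞ M) (hu : u ∈ e.target)
    (a : RMetric n M) (β : OneForm n M) :
    formNorm a β (e.symm u) = √(normSq (a.comp e u) (β.comp e u)) := by
  have ha := comp_posDef he hu a
  obtain ⟨t, ht⟩ : ∃ t, t = normSq (a.comp e u) (β.comp e u) := ⟨_, rfl⟩
  have ht0 : 0 ≤ t := ht ▸ normSq_nonneg ha _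
  refine IsGreatest.csSup_eq ⟨?_, ?_⟩
  · rw [← ht]
    obtain ⟨x, hx⟩ : ∃ x : Coord n, x.ofLp = (a.comp e u)⁻¹ *ᵥ β.comp e u :=
      ⟨WithLp.toLp 2 _, rfl⟩
    have hqx : quad (a.comp e u) x.ofLp = t := by rw [hx, ← normSq_eq_quad ha, ht]
    -- For `t = 0` the inverse is `0`, so the vector is zero and still attains the supremum `0`.
    refine ⟨coordVec e u ((√t)⁻¹ • x), ?_, ?_⟩
    · rw [Set.mem_ofPred_eq, norm_coordVec, alpha, WithLp.ofLp_smul, quad_smul, hqx, inv_pow,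
        Real.sq_sqrt ht0]
      refine Real.sqrt_le_one.2 ?_
      exact inv_mul_le_one
    · simp only [val_coordVec, WithLp.ofLp_smul, dotProduct_smul, hx]
      rw [← normSq, ← ht, smul_eq_mul, abs_of_nonneg (by positivity), inv_mul_eq_div,
        Real.div_sqrt]
  · rintro _ ⟨y, hy, rfl⟩
    obtain ⟨v, rfl⟩ := (coordVec_bijective he hu).2 y
    simp only [Set.mem_ofPred_eq] at hy
    rw [norm_coordVec, alpha, Real.sqrt_le_one] at hy
    simp only [val_coordVec]
    refine Real.abs_le_sqrt ((dotProduct_sq_le ha _ _).trans ?_)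
    exact mul_le_of_le_one_right (normSq_nonneg ha _) hy

lemma formNorm_sq (he : e ∈ IsManifold.maximalAtlas (𝓡 n) ∞ M) (hu : u ∈ e.target)
    (a : RMetric n M) (β : OneForm n M) :
    formNorm a β (e.symm u) ^ 2 = normSq (a.comp e u) (β.comp e u) := by
  rw [formNorm_eq he hu, Real.sq_sqrt (normSq_nonneg (comp_posDef he hu a) _)]

lemma inChart_genMetric (he : e ∈ IsManifold.maximalAtlas (𝓡 n) ∞ M) (hu : u ∈ e.target)
    (a : RMetric n M) (β : OneForm n M) (φ : ℝ × ℝ → ℝ) (y : Coord n) :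
    inChart (genMetric a β φ) e u y = localMetric (a.comp e) (β.comp e) φ u y := by
  rw [inChart, genMetric, formNorm_sq he hu, norm_coordVec, val_coordVec, localMetric, ratio]

/-- The tangent map of the inverse chart, composed with a constant vector field, is smooth;
evaluating the metric and the form on such fields gives smooth components. -/
lemma contMDiffOn_coordVec (he : e ∈ IsManifold.maximalAtlas (𝓡 n) ∞ M) (v : Coord n) :
    ContMDiffOn (𝓡 n) (𝓡 n).tangent ∞
      (fun u => (⟨e.symm u, coordVec e u v⟩ : TangentBundle (𝓡 n) M)) e.target := by
  have : IsManifold (𝓡 n) 1 M := IsManifold.of_le (n := ∞) (by simp)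
  have h1 := (contMDiffOn_symm_of_mem_maximalAtlas he).contMDiffOn_tangentMapWithin
    (m := ∞) (by simp) e.open_target.uniqueMDiffOn
  have h2 : ContMDiffOn (𝓡 n) (𝓡 n).tangent ∞
      (fun u : Coord n => (⟨u, v⟩ : TangentBundle (𝓡 n) (Coord n))) e.target :=
    contMDiffOn_vectorSpace_iff_contDiffOn.2 contDiffOn_const
  refine (h1.comp h2 fun u hu => hu).congr fun u hu => ?_
  simp only [Function.comp_apply, tangentMapWithin]
  rw [mfderivWithin_of_isOpen e.open_target hu]
  rfl

lemma contDiffAt_comp_metric (he : e ∈ IsManifold.maximalAtlas (𝓡 n) ∞ M) (hu : u ∈ e.target)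
    (a : RMetric n M) (i j : Fin n) : ContDiffAt ℝ ∞ (fun u' => a.comp e u' i j) u := by
  have hv := fun i => (contMDiffOn_coordVec he (EuclideanSpace.single i 1)).contMDiffAt
    (e.open_target.mem_nhds hu)
  have h : ContMDiffAt (𝓡 n) ((𝓡 n).prod 𝓘(ℝ, ℝ)) ∞
      (fun m => Bundle.TotalSpace.mk' ℝ (E := Bundle.Trivial M ℝ) (e.symm m)
        (a.inner (e.symm m) (coordVec e m (EuclideanSpace.single i 1))
          (coordVec e m (EuclideanSpace.single j 1)))) u := by
    apply ContMDiffAt.clm_bundle_apply₂ (F₁ := Coord n) (F₂ := Coord n)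
    · exact ContMDiffAt.comp u a.contMDiff.contMDiffAt (contMDiffAt_symm_of_mem_maximalAtlas he hu)
    · exact hv i
    · exact hv j
  rw [Bundle.contMDiffAt_totalSpace] at h
  exact h.2.contDiffAt

lemma contDiffAt_comp_form (he : e ∈ IsManifold.maximalAtlas (𝓡 n) ∞ M) (hu : u ∈ e.target)
    (β : OneForm n M) (i : Fin n) : ContDiffAt ℝ ∞ (fun u' => β.comp e u' i) u := by
  have hv := (contMDiffOn_coordVec he (EuclideanSpace.single i 1)).contMDiffAt
    (e.open_target.mem_nhds hu)
  have h : ContMDiffAt (𝓡 n) ((𝓡 n).prod 𝓘(ℝ, ℝ)) ∞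
      (fun m => Bundle.TotalSpace.mk' ℝ (E := Bundle.Trivial M ℝ) (e.symm m)
        (β (e.symm m) (coordVec e m (EuclideanSpace.single i 1)))) u := by
    apply ContMDiffAt.clm_bundle_apply (F₁ := Coord n)
    · exact ContMDiffAt.comp u β.contMDiff.contMDiffAt (contMDiffAt_symm_of_mem_maximalAtlas he hu)
    · exact hv
  rw [Bundle.contMDiffAt_totalSpace] at h
  exact h.2.contDiffAt

lemma isConformalPair (he : e ∈ IsManifold.maximalAtlas (𝓡 n) ∞ M) {a : RMetric n M}
    {β : OneForm n M} {c : M → ℝ} (hβ : IsClosedConformal a β c) :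
    IsConformalPair (a.comp e) (β.comp e) (fun u => c (e.symm u)) e.target where
  isOpen := e.open_target
  contDiffAt_metric _ hu := contDiffAt_comp_metric he hu a
  contDiffAt_form _ hu := contDiffAt_comp_form he hu β
  posDef _ hu := comp_posDef he hu a
  covDeriv_eq := hβ e he

end

/-! ### The equation `H₂ = s H₂₂` on a slice `b² = t` -/

/-- The solutions of `h' = s h''`. -/
lemma eq_quadratic_of_ode {h h₁ h₂ h₃ : ℝ → ℝ} {β : ℝ} (hβ : 0 ≤ β)
    (d : ∀ s, s ^ 2 ≤ β ^ 2 → HasDerivAt h (h₁ s) s)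
    (d₁ : ∀ s, s ^ 2 ≤ β ^ 2 → HasDerivAt h₁ (h₂ s) s)
    (d₂ : ∀ s, s ^ 2 ≤ β ^ 2 → HasDerivAt h₂ (h₃ s) s) (hc : ContinuousAt h₃ 0)
    (ho : ∀ s, s ^ 2 ≤ β ^ 2 → h₁ s = s * h₂ s) {s : ℝ} (hs : s ^ 2 ≤ β ^ 2) :
    h s = (2 * h 0 + h₂ 0 * s ^ 2) / 2 := by
  rcases hβ.eq_or_lt with rfl | hβ
  · have : s = 0 := by nlinarith [sq_nonneg s]
    rw [this]
    ring
  have hI : ∀ s ∈ Set.Ioo (-β) β, s ^ 2 ≤ β ^ 2 := fun s hs => (sq_lt_sq' hs.1 hs.2).le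
  have hI0 : (0 : ℝ) ∈ Set.Ioo (-β) β := ⟨by linarith, hβ⟩
  -- Differentiate `h₁ = s h₂`. Division by `s` fails at `0`, where continuity of `h₃` is used
  -- instead.
  have h3 : ∀ s ∈ Set.Ioo (-β) β, s * h₃ s = 0 := fun s hs => by
    have e : HasDerivAt h₁ (1 * h₂ s + s * h₃ s) s :=
      ((hasDerivAt_id s).mul (d₂ s (hI s hs))).congr_of_eventuallyEq
        ((isOpen_Ioo.eventually_mem hs).mono fun r hr => ho r (hI r hr))
    linarith [e.unique (d₁ s (hI s hs))]
  have h30 : h₃ 0 = 0 := by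
    refine tendsto_nhds_unique (hc.tendsto.mono_left (nhdsWithin_le_nhds (s := {0}ᶜ))) ?_
    refine tendsto_const_nhds.congr' ?_
    filter_upwards [self_mem_nhdsWithin, nhdsWithin_le_nhds (isOpen_Ioo.mem_nhds hI0)] with r h0 hr
    exact ((mul_eq_zero.1 (h3 r hr)).resolve_left h0).symm
  have h3' : ∀ s ∈ Set.Ioo (-β) β, h₃ s = 0 := fun s hs => by
    rcases mul_eq_zero.1 (h3 s hs) with rfl | h
    exacts [h30, h]
  have c₂ : ∀ s ∈ Set.Ioo (-β) β, h₂ s = h₂ 0 := fun s hs =>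
    isOpen_Ioo.is_const_of_deriv_eq_zero isPreconnected_Ioo
      (fun x hx => (d₂ x (hI x hx)).differentiableAt.differentiableWithinAt)
      (fun x hx => ((d₂ x (hI x hx)).congr_deriv (h3' x hx)).deriv) hs hI0
  have dE : ∀ s ∈ Set.Ioo (-β) β, HasDerivAt (fun r => h r - h₂ 0 / 2 * r ^ 2) 0 s :=
    fun s hs => ((d s (hI s hs)).sub ((hasDerivAt_pow 2 s).const_mul (h₂ 0 / 2))).congr_deriv
      (by rw [ho s (hI s hs), c₂ s hs]; push_cast; ring)
  have he : Set.EqOn h (fun s => (2 * h 0 + h₂ 0 * s ^ 2) / 2) (Set.Ioo (-β) β) := fun s hs => by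
    have := isOpen_Ioo.is_const_of_deriv_eq_zero isPreconnected_Ioo
      (fun x hx => (dE x hx).differentiableAt.differentiableWithinAt)
      (fun x hx => (dE x hx).deriv) hs hI0
    simp only at this ⊢
    linarith
  have hcl : Set.Icc (-β) β ⊆ closure (Set.Ioo (-β) β) := by
    rw [closure_Ioo (by linarith)]
  exact he.of_subset_closure
    (fun s hs => (d s (sq_le_sq' hs.1 hs.2)).continuousAt.continuousWithinAt)
    (by fun_prop) Set.Ioo_subset_Icc_self hcl (abs_le.1 (abs_le_of_sq_le_sq hs hβ.le))

section

variable {φ : ℝ × ℝ → ℝ} {t : ℝ}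

lemma IsAdmissible.pdeNum_eq_iff (h : IsAdmissible φ t) {s r : ℝ} (hs : s ^ 2 ≤ t) :
    pdeNum φ (t, s) = r * pdeDen φ (t, s) ↔ Hfun φ (t, s) = r / 2 := by
  have h0 := h.den_pos s hs
  rw [Hfun, div_eq_div_iff (by positivity) two_ne_zero]
  constructor <;> intro e <;> linarith

/-- A solution of `H₂ = s H₂₂` is a quadratic polynomial in `s` without linear term. -/
lemma IsAdmissible.Hfun_eq_of_ode (h : IsAdmissible φ t)
    (ho : ∀ s, s ^ 2 ≤ t → d2 (Hfun φ) (t, s) - s * d2 (d2 (Hfun φ)) (t, s) = 0) {s : ℝ}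
    (hs : s ^ 2 ≤ t) :
    Hfun φ (t, s) = (2 * Hfun φ (t, 0) + d2 (d2 (Hfun φ)) (t, 0) * s ^ 2) / 2 := by
  have ht : 0 ≤ t := (sq_nonneg s).trans hs
  have hβ := Real.sq_sqrt ht
  have hc : ContDiffAt ℝ ∞ (fun r : ℝ => d2 (d2 (d2 (Hfun φ))) (t, r)) 0 :=
    (contDiffAt_d2 (contDiffAt_d2 (contDiffAt_d2 (h.contDiffAt_Hfun (by simpa using ht))))).comp 0
      (contDiffAt_const.prodMk contDiffAt_id)
  refine eq_quadratic_of_ode (h := fun r => Hfun φ (t, r)) (h₁ := fun r => d2 (Hfun φ) (t, r))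
    (h₂ := fun r => d2 (d2 (Hfun φ)) (t, r)) (h₃ := fun r => d2 (d2 (d2 (Hfun φ))) (t, r))
    (Real.sqrt_nonneg t) (fun r hr => ?_) (fun r hr => ?_) (fun r hr => ?_) hc.continuousAt
    (fun r hr => ?_) (hβ.symm ▸ hs)
  all_goals rw [hβ] at hr
  · exact hasDerivAt_d2 (h.contDiffAt_Hfun hr).differentiableAt_infty
  · exact hasDerivAt_d2 (contDiffAt_d2 (h.contDiffAt_Hfun hr)).differentiableAt_infty
  · exact hasDerivAt_d2 (contDiffAt_d2
      (contDiffAt_d2 (h.contDiffAt_Hfun hr))).differentiableAt_infty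
  · exact sub_eq_zero.1 (ho r hr)

/-- A quadratic polynomial in `s` without linear term solves `H₂ = s H₂₂`. -/
lemma IsAdmissible.ode_of_Hfun_eq (h : IsAdmissible φ t) (ht : 0 < t) {f g : ℝ}
    (hfg : ∀ s, s ^ 2 ≤ t → Hfun φ (t, s) = (f + g * s ^ 2) / 2) {s : ℝ} (hs : s ^ 2 ≤ t) :
    d2 (Hfun φ) (t, s) - s * d2 (d2 (Hfun φ)) (t, s) = 0 := by
  obtain ⟨β, hβ0, hβ⟩ : ∃ β : ℝ, 0 < β ∧ β ^ 2 = t :=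
    ⟨√t, Real.sqrt_pos.2 ht, Real.sq_sqrt ht.le⟩
  have hI : ∀ r ∈ Set.Icc (-β) β, r ^ 2 ≤ t := fun r hr => hβ ▸ sq_le_sq' hr.1 hr.2
  -- The formula for `H` holds only on the closed slice, so derivatives at its endpoints are
  -- compared one-sidedly; the slice is a nondegenerate interval because `t > 0`.
  have hu : UniqueDiffOn ℝ (Set.Icc (-β) β) := uniqueDiffOn_Icc (by linarith)
  have h1 : ∀ r ∈ Set.Icc (-β) β, d2 (Hfun φ) (t, r) = g * r := fun r hr => by
    have e1 := (hasDerivAt_d2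
      (h.contDiffAt_Hfun (hI r hr)).differentiableAt_infty).hasDerivWithinAt (s := Set.Icc (-β) β)
    have e2 : HasDerivWithinAt (fun s => Hfun φ (t, s)) (g * r) (Set.Icc (-β) β) r :=
      HasDerivWithinAt.congr (((((hasDerivAt_pow 2 r).const_mul g).const_add f).div_const
        2).congr_deriv (by push_cast; ring) : HasDerivAt _ (g * r) r).hasDerivWithinAt
        (fun x hx => hfg x (hI x hx)) (hfg r (hI r hr))
    exact (hu r hr).eq_deriv _ e1 e2
  have h2 : ∀ r ∈ Set.Icc (-β) β, d2 (d2 (Hfun φ)) (t, r) = g := fun r hr => by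
    have e1 := (hasDerivAt_d2 (contDiffAt_d2
      (h.contDiffAt_Hfun (hI r hr))).differentiableAt_infty).hasDerivWithinAt (s := Set.Icc (-β) β)
    have e2 : HasDerivWithinAt (fun s => d2 (Hfun φ) (t, s)) g (Set.Icc (-β) β) r :=
      HasDerivWithinAt.congr (((hasDerivAt_id r).const_mul g).congr_deriv (by ring) :
        HasDerivAt _ g r).hasDerivWithinAt h1 (h1 r hr)
    exact (hu r hr).eq_deriv _ e1 e2
  have hs' : s ∈ Set.Icc (-β) β := abs_le.1 (abs_le_of_sq_le_sq (hβ ▸ hs) hβ0.le)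
  rw [h1 s hs', h2 s hs']
  ring

end

/-! ### Zeros of the form, and passage from charts to the manifold -/

namespace IsConformalPair

variable {n : ℕ} {a : Coord n → Matrix (Fin n) (Fin n) ℝ} {b : Coord n → Fin n → ℝ}
  {c : Coord n → ℝ} {Ω : Set (Coord n)} {u : Coord n}

/-- The 1-form does not vanish identically near any point where `c ≠ 0`. -/
lemma frequently_normSq_ne_zero (hn : 0 < n) (hM : IsConformalPair a b c Ω) (hu : u ∈ Ω)
    (hc : c u ≠ 0) : ∃ᶠ u' in nhds u, normSq (a u') (b u') ≠ 0 := by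
  intro h
  let i : Fin n := ⟨0, hn⟩
  have h0 : ∀ᶠ u' in nhds u, b u' = 0 := by
    filter_upwards [h, hM.eventually_mem hu] with z hz hzΩ
    exact eq_zero_of_normSq (hM.posDef z hzΩ) (not_not.1 hz)
  have h1 : pd (fun u' => b u' i) i u = 0 := by
    rw [pd_congr (h0.mono fun z hz => congrFun hz i) i]
    exact (hasGrad_const 0).pd i
  have h2 := hM.covDeriv_eq u hu i i
  rw [covDeriv, h1, h0.self_of_nhds] at h2
  have h3 := (hM.posDef u hu).diag_pos (i := i)
  simp only [Pi.zero_apply, mul_zero, Finset.sum_const_zero, sub_zero] at h2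
  exact mul_ne_zero hc h3.ne' h2.symm

end IsConformalPair

section

variable {n : ℕ} {M : Type*} [TopologicalSpace M] [ChartedSpace (Coord n) M]
  [IsManifold (𝓡 n) ∞ M]

/-- Every point of a manifold is in the domain of a chart. -/
lemma exists_chart (x : M) : ∃ e ∈ IsManifold.maximalAtlas (𝓡 n) ∞ M, ∃ u ∈ e.target,
    e.symm u = x :=
  ⟨chartAt (Coord n) x, IsManifold.chart_mem_maximalAtlas x, chartAt (Coord n) x x,
    mem_chart_target _ x, (chartAt (Coord n) x).left_inv (mem_chart_source _ x)⟩

lemma formNorm_nonneg (a : RMetric n M) (β : OneForm n M) (x : M) : 0 ≤ formNorm a β x := by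
  obtain ⟨e, he, u, hu, rfl⟩ := exists_chart (n := n) x
  rw [formNorm_eq he hu]
  positivity

lemma abs_le_formNorm_iff (a : RMetric n M) (β : OneForm n M) (x : M) (s : ℝ) :
    |s| ≤ formNorm a β x ↔ s ^ 2 ≤ formNorm a β x ^ 2 := by
  rw [sq_le_sq, abs_of_nonneg (formNorm_nonneg a β x)]

/-- Smoothness and positivity come from the domain of `φ`; positivity of the denominator comes from
strong convexity in any chart around the point. -/
lemma isAdmissible_formNorm (hn : 2 ≤ n) {a : RMetric n M} {β : OneForm n M} {φ : ℝ × ℝ → ℝ}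
    {b₀ : EReal} (hφ : IsPhi φ b₀) (hb : ∀ x : M, (formNorm a β x : EReal) < b₀)
    (hF : IsFinslerMetric (genMetric a β φ)) {c : M → ℝ} (hβ : IsClosedConformal a β c) (x : M) :
    IsAdmissible φ (formNorm a β x ^ 2) := by
  have hdom : ∀ s : ℝ, s ^ 2 ≤ formNorm a β x ^ 2 → (formNorm a β x ^ 2, s) ∈ phiDomain b₀ :=
    fun s hs => ⟨formNorm a β x, rfl, (abs_le_formNorm_iff a β x s).2 hs, hb x⟩
  obtain ⟨U, hU, hUd, hUφ⟩ := hφ.smooth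
  have hsm : ∀ s : ℝ, s ^ 2 ≤ formNorm a β x ^ 2 → ContDiffAt ℝ ∞ φ (formNorm a β x ^ 2, s) :=
    fun s hs => hUφ.contDiffAt (hU.mem_nhds (hUd (hdom s hs)))
  have hpos : ∀ s : ℝ, s ^ 2 ≤ formNorm a β x ^ 2 → 0 < φ (formNorm a β x ^ 2, s) :=
    fun s hs => hφ.pos _ (hdom s hs)
  refine ⟨hsm, hpos, ?_⟩
  obtain ⟨e, he, u, hu, rfl⟩ := exists_chart (n := n) x
  rw [formNorm_sq he hu] at hsm hpos ⊢
  exact fun s hs => (isConformalPair he hβ).pdeDen_pos hn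
    (fun u hu y => inChart_genMetric he hu a β φ y) hu hsm hpos (hF.convex e he u hu) hs

end

end GeneralAlphaBeta

end

/-! ### The equivalence of the four conditions -/

open GeneralAlphaBeta in
theorem theorem1p1 {n : ℕ} (hn : 2 ≤ n) {M : Type*} [TopologicalSpace M]
    [ChartedSpace (Coord n) M] [IsManifold (𝓡 n) ∞ M]
    (a : RMetric n M) (β : OneForm n M) (φ : ℝ × ℝ → ℝ) (b₀ : EReal)
    (hφ : IsPhi φ b₀) (hb : ∀ x : M, (formNorm a β x : EReal) < b₀)
    (hF : IsFinslerMetric (genMetric a β φ)) (hR : ¬ IsRiemannian (genMetric a β φ))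
    (c : M → ℝ) (hc : ∀ x, c x ≠ 0) (hβ : IsClosedConformal a β c) :
    List.TFAE [
      IsDouglas (genMetric a β φ),
      ∃ f g : ℝ → ℝ,
        ContDiffOn ℝ ∞ f (Set.range fun x : M => formNorm a β x ^ 2) ∧
        ContDiffOn ℝ ∞ g (Set.range fun x : M => formNorm a β x ^ 2) ∧
        ∀ (x : M) (s : ℝ), |s| ≤ formNorm a β x →
          pdeNum φ (formNorm a β x ^ 2, s) =
            (f (formNorm a β x ^ 2) + g (formNorm a β x ^ 2) * s ^ 2) *
              pdeDen φ (formNorm a β x ^ 2, s),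
      ∃ f g : ℝ → ℝ, ∀ (x : M) (s : ℝ), |s| ≤ formNorm a β x →
          pdeNum φ (formNorm a β x ^ 2, s) =
            (f (formNorm a β x ^ 2) + g (formNorm a β x ^ 2) * s ^ 2) *
              pdeDen φ (formNorm a β x ^ 2, s),
      ∀ (x : M) (s : ℝ), |s| ≤ formNorm a β x →
        d2 (Hfun φ) (formNorm a β x ^ 2, s) - s * d2 (d2 (Hfun φ)) (formNorm a β x ^ 2, s) = 0] := by
  have hA := isAdmissible_formNorm hn hφ hb hF hβ
  simp only [abs_le_formNorm_iff]
  tfae_have 1 → 3 := by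
    intro hD
    -- The coefficients are chosen per value `t`, not per point: `H` sees `x` only through `b²`, so
    -- one point of each level decides. Values not attained get `0`.
    have key : ∀ t, ∃ f g : ℝ, ∀ x : M, formNorm a β x ^ 2 = t → ∀ s, s ^ 2 ≤ t →
        Hfun φ (t, s) = (f + g * s ^ 2) / 2 := by
      intro t
      by_cases h : ∃ x : M, formNorm a β x ^ 2 = t
      · obtain ⟨x, rfl⟩ := h
        have hAx := hA x
        obtain ⟨e, he, u, hu, rfl⟩ := exists_chart (n := n) x
        simp only [formNorm_sq he hu] at hAx ⊢
        obtain ⟨f, g, hfg⟩ := (isConformalPair he hβ).exists_Hfun_eq hn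
          (fun u hu y => inChart_genMetric he hu a β φ y) hu (hc _) hAx (hF.convex e he u hu)
          fun i j k l y hy => hD e he u hu y hy i j k l
        exact ⟨f, g, fun _ _ => hfg⟩
      · exact ⟨0, 0, fun x hx => absurd ⟨x, hx⟩ h⟩
    choose f g hfg using key
    exact ⟨f, g, fun x s hs => ((hA x).pdeNum_eq_iff hs).2 (hfg _ x rfl s hs)⟩
  tfae_have 3 → 1 := by
    rintro ⟨f, g, hfg⟩ e he u hu y hy i j k l
    have hAx := hA (e.symm u)
    have hfgx := hfg (e.symm u)
    rw [formNorm_sq he hu] at hAx hfgx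
    exact (isConformalPair he hβ).douglasCoeff_eq_zero
      (fun u hu y => inChart_genMetric he hu a β φ y) hu hAx (hF.convex e he u hu)
      ⟨_, _, fun s hs => (hAx.pdeNum_eq_iff hs).1 (hfgx s hs)⟩ hy i j k l
  tfae_have 3 → 4 := by
    rintro ⟨f, g, hfg⟩
    have hpos : ∀ x : M, 0 < formNorm a β x ^ 2 → ∀ s, s ^ 2 ≤ formNorm a β x ^ 2 →
        d2 (Hfun φ) (formNorm a β x ^ 2, s) - s * d2 (d2 (Hfun φ)) (formNorm a β x ^ 2, s) = 0 :=
      fun x hx s hs => (hA x).ode_of_Hfun_eq hx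
        (fun r hr => ((hA x).pdeNum_eq_iff hr).1 (hfg x r hr)) hs
    intro x s hs
    -- At a zero of `β` the claim is `H₂(0, 0) = 0`. It holds as a limit of `H₂(b², 0) = 0` along
    -- nearby points with `b ≠ 0`.
    rcases (sq_nonneg (formNorm a β x)).eq_or_lt with h0 | h0
    · have hs0 : s = 0 := by nlinarith [sq_nonneg s]
      have hAx := (hA x).contDiffAt_Hfun (s := 0) (by simp [sq_nonneg])
      subst hs0
      obtain ⟨e, he, u, hu, rfl⟩ := exists_chart (n := n) x
      have hM := isConformalPair he hβ
      rw [formNorm_sq he hu] at hAx ⊢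
      have hcont : ContinuousAt (fun u' => d2 (Hfun φ) (normSq (a.comp e u') (β.comp e u'), 0)) u :=
        ContinuousAt.comp (f := fun u' => (normSq (a.comp e u') (β.comp e u'), (0 : ℝ)))
          (contDiffAt_d2 hAx).continuousAt ((hM.contDiffAt_normSq hu).continuousAt.prodMk continuousAt_const)
      have hfr : ∃ᶠ u' in nhds u,
          d2 (Hfun φ) (normSq (a.comp e u') (β.comp e u'), 0) ∈ ({0} : Set ℝ) := by
        refine ((hM.frequently_normSq_ne_zero (by omega) hu (hc _)).and_eventually
          (hM.eventually_mem hu)).mono fun u' hu' => ?_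
        have h1 := hpos (e.symm u')
        rw [formNorm_sq he hu'.2] at h1
        have h2 := normSq_nonneg (hM.posDef u' hu'.2) (β.comp e u')
        have h3 := h1 (h2.lt_of_ne' hu'.1) 0 (by simpa using h2)
        rwa [zero_mul, sub_zero] at h3
      have := isClosed_singleton.mem_of_frequently_of_tendsto hfr hcont.tendsto
      rw [zero_mul, sub_zero]
      exact this
    · exact hpos x h0 s hs
  tfae_have 4 → 2 := by
    intro h
    have h0 : ∀ x : M, ContDiffAt ℝ ∞ (Hfun φ) (formNorm a β x ^ 2, 0) := fun x =>
      (hA x).contDiffAt_Hfun (by simp [sq_nonneg])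
    have hι : ∀ t : ℝ, ContDiffAt ℝ ∞ (fun t : ℝ => (t, (0 : ℝ))) t := fun t =>
      contDiffAt_id.prodMk contDiffAt_const
    -- The Taylor coefficients of `2 H` at `s = 0`, which inherit smoothness in `t` from `H`.
    refine ⟨fun t => 2 * Hfun φ (t, 0), fun t => d2 (d2 (Hfun φ)) (t, 0), ?_, ?_,
      fun x s hs => ((hA x).pdeNum_eq_iff hs).2 ((hA x).Hfun_eq_of_ode (h x) hs)⟩
    · rintro _ ⟨x, rfl⟩
      exact (contDiffAt_const.mul (ContDiffAt.comp (f := fun t : ℝ => (t, (0 : ℝ))) _ (h0 x) (hι _))).contDiffWithinAt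
    · rintro _ ⟨x, rfl⟩
      exact (ContDiffAt.comp (f := fun t : ℝ => (t, (0 : ℝ))) _
        (contDiffAt_d2 (contDiffAt_d2 (h0 x))) (hι _)).contDiffWithinAt
  tfae_have 2 → 3 := fun ⟨f, g, _, _, h⟩ => ⟨f, g, h⟩
  tfae_finish
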